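/- **Setting.** A trace $t$ of $n$ events over $k$ processes is a sequence of events $e_1,\dots,e_n$; each event belongs to one process and is a read or a write of a global variable, or an acquire or a release of a lock. Every read is preceded in $t$ by a write to the same variable; every release of a lock is preceded by an acquire of that lock by the same process with no acquire or release of the lock in between (its *matching* acquire); between two acquires of a lock there is a release of it. The write *observed* by a read $r$ is the last write to the variable of $r$ before $r$ in $t$. Let $X$ be a set of events of $t$ that contains the write observed by each of its reads and the matching acquire of each of its releases (as every feasible set does). A partial order $P$ on $X$ *respects* $t$ if it orders the events of each process as $t$ does and puts each read in $X$ after the write it observes. A partial order $Q$ on $X$ *refines* $P$ ($Q\sqsubseteq P$) if $a\le_P b$ implies $a\le_Q b$. $Q$ is *closed* if * for every read $r\in X$ with observed write $w$ and every other write $w'\in X$ to the same variable, $w'<_Q r$ implies $w'<_Q w$, and $w<_Q w'$ implies $r<_Q w'$; * for all distinct releases $\ell_1,\ell_2\in X$ of the same lock with matching acquires $a_1,a_2$, $a_1<_Q\ell_2$ implies $\ell_1<_Q a_2$. The *closure* of $P$ is the smallest closed partial order on $X$ refining $P$, that is, a closed $Q\sqsubseteq P$ such that $Q'\sqsubseteq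 Q$ for every closed $Q'\sqsubseteq P$. **The data structure.** $\mathsf{DS}$ stores a partial order consisting of $k$ total orders (the events of each process, in trace order) with orderings across them: for each pair of processes $i\ne j$, a balanced binary tree for suffix minima, storing for the events of process $i$ the earliest event of process $j$ recorded to be ordered after them. A query $a\le b$ is one suffix minimum; an insertion of $a\to b$ orders, for all $i\neq j$, the last event of $i$ at or before $a$ before the first event of $j$ at or after $b$. **The algorithm $\mathsf{Closure}$.** Its input is $t$, $X$ and the matrix of $P$. It builds the event maps with values in $X$: the observed writes, matching acquires and releases; the flow map (the last read of each process observing a given write); and the first/last write to a given variable, or first release of a given lock, at or after/before a given event in its process. It initializes $\mathsf{DS}$ with $P$ and applies the following rules to every pair $e_1<_P e_2$, pushing orderings on a worklist. * If $e_1$ is a write and $w'$ is the first write to its variable at or after $e_2$ in the process of $e_2$, push $r\to w'$ for the last read $r$ of each process observing $e_1$. * If $e_2$ is a read observing $w$, and $w'\ne w$ is the last write to its variable at or before $e_1$ in the process of $e_1$, push $w'\to w$. * If $e_1$ is an acquire with matching release $\ell_1 \in X$ and $\ell_2\neq\ell_1$ is the first release of its lock at or after $e_2$ in the process of $e_2$,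 push $\ell_1\to a_2$ with $a_2$ the acquire matching $\ell_2$. While the worklist is non-empty, it pops an ordering $a\to b$: if $b\le a$ in $\mathsf{DS}$ it returns $\bot$; if $a\le b$ already, it continues; otherwise it inserts $a\to b$ in $\mathsf{DS}$ and applies the rules to every pair $(e_1,e_2)$ that has become ordered. When the worklist is empty it returns $\mathsf{DS}$. Time is the number of steps of a unit-cost random access machine. **Theorem.** For every $k$ there is a constant $C$ such that the following hold. 1. For every trace $t$ of $n$ events over $k$ processes, every $X$ as above and every partial order $P$ on $X$ that respects $t$, the algorithm $\mathsf{Closure}$ halts. Either it returns a data structure that represents the closure of $P$ (its queries answer whether $a\le b$ in the closure, for all $a,b\in X$), or it returns $\bot$ and no closed partial order on $X$ refines $P$, so that $P$ has no closure. If $n\ge 2$, it takes at most $C\,n^2\log n$ steps. 2. For $n\ge2$, the initialization of $\mathsf{DS}$ with the $k$ total orders takes at most $Cn$ steps, and every query and every insertion takes at most $C\log n$ steps. -/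

import Mathlib

/-! ### Traces -/

/-- The four kinds of events: read or write of a global variable, acquire or release of a lock. -/
inductive Op
  | read
  | write
  | acq
  | rel
  deriving DecidableEq

/-- An event: its process, its kind, and the global variable (for `read`, `write`) or the lock
(for `acq`, `rel`) it accesses. Variables and locks are never compared with each other. -/
structure Event (k : ℕ) where
  proc : Fin k
  op : Op
  loc : ℕ

/-- A trace of `n` events over `k` processes; the events are identified with their positions, so
`<` on `Fin n` is the trace order. Every read has an earlier write to its variable, every release
closes a critical section opened by the same process, and critical sections on a lock do not
overlap. -/
structure Trace (k n : ℕ) where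
  ev : Fin n → Event k
  read_observes : ∀ r, (ev r).op = Op.read →
    ∃ w, w < r ∧ (ev w).op = Op.write ∧ (ev w).loc = (ev r).loc
  rel_closes : ∀ l, (ev l).op = Op.rel →
    ∃ a, a < l ∧ (ev a).op = Op.acq ∧ (ev a).loc = (ev l).loc ∧ (ev a).proc = (ev l).proc ∧
      ∀ e, a < e → e < l → ((ev e).op = Op.acq ∨ (ev e).op = Op.rel) → (ev e).loc ≠ (ev l).loc
  acq_exclusive : ∀ a b, a < b → (ev a).op = Op.acq → (ev b).op = Op.acq →
    (ev a).loc = (ev b).loc → ∃ l, a < l ∧ l < b ∧ (ev l).op = Op.rel ∧ (ev l).loc = (ev a).loc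

namespace Trace

variable {k n : ℕ}

/-- The read `r` observes `w`: `w` is the last write to the variable of `r` before `r`.
(The graph of the observation function of the trace.) -/
def Observes (t : Trace k n) (r w : Fin n) : Prop :=
  (t.ev r).op = Op.read ∧ (t.ev w).op = Op.write ∧ (t.ev w).loc = (t.ev r).loc ∧ w < r ∧
    ∀ w', (t.ev w').op = Op.write → (t.ev w').loc = (t.ev r).loc → w' < r → w' ≤ w

/-- The acquire `a` and the release `l` delimit a critical section. -/
def Matching (t : Trace k n) (a l : Fin n) : Prop :=
  (t.ev a).op = Op.acq ∧ (t.ev l).op = Op.rel ∧ (t.ev a).loc = (t.ev l).loc ∧ a < l ∧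
    ∀ e, a < e → e < l → ((t.ev e).op = Op.acq ∨ (t.ev e).op = Op.rel) →
      (t.ev e).loc ≠ (t.ev l).loc

/-- `X` contains the write observed by each of its reads, and the acquire matching each of its
releases. Any further requirement on feasible sets (being prefix-closed in every process, having
at most one open critical section per lock) is not imposed here, so that more sets are allowed. -/
structure Feasible (t : Trace k n) (X : Finset (Fin n)) : Prop where
  observed_mem : ∀ r ∈ X, ∀ w, t.Observes r w → w ∈ X
  acquire_mem : ∀ l ∈ X, ∀ a, t.Matching a l → a ∈ X

/-- The partial order `P` on `X` respects `t`: it orders the events of each process as `t` does,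
and every read after the write that it observes in `t`. -/
structure Respects (t : Trace k n) {X : Finset (Fin n)} (P : PartialOrder X) : Prop where
  process_order : ∀ a b : X, (t.ev a).proc = (t.ev b).proc → a.1 < b.1 → P.lt a b
  reads_from : ∀ r w : X, t.Observes r w → P.lt w r

/-- Observation-closed and lock-closed partial orders. -/
structure Closed (t : Trace k n) {X : Finset (Fin n)} (Q : PartialOrder X) : Prop where
  /-- A write that precedes a read precedes the write observed by that read. -/
  obs_before : ∀ r w w' : X, t.Observes r w → (t.ev w').op = Op.write →
    (t.ev w').loc = (t.ev r).loc → w' ≠ w → Q.lt w' r → Q.lt w' w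
  /-- A write that follows the write observed by a read follows that read. -/
  obs_after : ∀ r w w' : X, t.Observes r w → (t.ev w').op = Op.write →
    (t.ev w').loc = (t.ev r).loc → w' ≠ w → Q.lt w w' → Q.lt r w'
  /-- If an acquire precedes the release of another critical section on the same lock, then its
  critical section precedes the other one. -/
  lock : ∀ a₁ l₁ a₂ l₂ : X, t.Matching a₁ l₁ → t.Matching a₂ l₂ →
    (t.ev l₁).loc = (t.ev l₂).loc → l₁ ≠ l₂ → Q.lt a₁ l₂ → Q.lt l₁ a₂

end Trace

/-- `Q` refines `P` (`Q ⊑ P`). -/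
def Refines {α : Type} (Q P : PartialOrder α) : Prop :=
  ∀ a b, P.le a b → Q.le a b

/-- `Q` is the closure of `P`: the smallest closed partial order refining `P`. -/
structure Trace.IsClosure {k n : ℕ} (t : Trace k n) {X : Finset (Fin n)}
    (P Q : PartialOrder X) : Prop where
  refines : Refines Q P
  closed : t.Closed Q
  least : ∀ Q' : PartialOrder X, Refines Q' P → t.Closed Q' → Refines Q' Q

/-! ### Step counting

Algorithms are written in a monad that counts steps. One step pays for a bounded number of
elementary operations of a unit-cost random access machine: arithmetic and comparisons of numbers,
access to one cell of an array, allocation of one list cell or tree node. Every iteration of a loop,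
every recursive call and every cell of a new array is charged. Arrays are written as functions on
`Fin m`, and a write to a cell is a `Function.update`. -/

/-- A value together with the number of steps spent to compute it. -/
structure Timed (α : Type) where
  val : α
  steps : ℕ

namespace Timed

instance : Monad Timed where
  pure a := ⟨a, 0⟩
  bind m f := ⟨(f m.val).val, m.steps + (f m.val).steps⟩

/-- Spend `c` steps. -/
def tick (c : ℕ) : Timed Unit := ⟨(), c⟩

/-- Allocate an array of `m` cells. -/
def alloc {α : Type} (m : ℕ) (v : α) : Timed (Fin m → α) := do
  tick (m + 1)
  pure fun _ => v

/-- Loop over a list; each iteration is charged one step besides the cost of the body. -/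
def foreach {α σ : Type} : List α → σ → (σ → α → Timed σ) → Timed σ
  | [], s, _ => do
    tick 1
    pure s
  | a :: as, s, body => do
    tick 1
    let s' ← body s a
    foreach as s' body

end Timed

open Timed (tick alloc)

/-! ### The partial-order data structure -/

/-- Perfect binary trees of height `h` storing an array of `2 ^ h` numbers in the leaves; each
inner node stores the minimum of the leaves below it. -/
inductive MinTree : ℕ → Type
  | leaf (v : ℕ) : MinTree 0
  | node {h : ℕ} (m : ℕ) (l r : MinTree h) : MinTree (h + 1)

namespace MinTree

/-- The minimum of the whole array. -/
def top : {h : ℕ} → MinTree h → ℕ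
  | _, leaf v => v
  | _, node m _ _ => m

/-- The constant array. -/
def build (v : ℕ) : (h : ℕ) → Timed (MinTree h)
  | 0 => do
    tick 1
    pure (leaf v)
  | h + 1 => do
    tick 1
    let l ← build v h
    let r ← build v h
    pure (node v l r)

/-- Lower the cell `i` to `v` (if its value is larger than `v`). -/
def lower : {h : ℕ} → MinTree h → ℕ → ℕ → Timed (MinTree h)
  | _, leaf u, _, v => do
    tick 1
    pure (leaf (min u v))
  | h + 1, node m l r, i, v => do
    tick 1
    if i < 2 ^ h then
      let l' ← l.lower i v
      pure (node (min m v) l' r)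
    else
      let r' ← r.lower (i - 2 ^ h) v
      pure (node (min m v) l r')

/-- The minimum of the cells with index at least `i`. -/
def suffixMin : {h : ℕ} → MinTree h → ℕ → Timed ℕ
  | _, leaf u, _ => do
    tick 1
    pure u
  | h + 1, node _ l r, i => do
    tick 1
    if i < 2 ^ h then
      let m ← l.suffixMin i
      pure (min m r.top)
    else
      r.suffixMin (i - 2 ^ h)

/-- The largest index of a cell with value at most `v`. -/
def lastLE : {h : ℕ} → MinTree h → ℕ → Timed (Option ℕ)
  | _, leaf u, v => do
    tick 1
    pure (if u ≤ v then some 0 else none)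
  | h + 1, node _ l r, v => do
    tick 1
    if r.top ≤ v then
      let i ← r.lastLE v
      pure (i.map (· + 2 ^ h))
    else
      l.lastLE v

end MinTree

/-- The data structure: `k` total orders (the events of each process, in trace order) with
orderings across them. For processes `i ≠ j`, the tree `tree i j` stores an array indexed by the
events of the trace; a value `g < n` at index `f` is an ordering of the event `f` of process `i`
before the event `g` of process `j`, and the value `n` means that there is none. -/
structure DS (k n : ℕ) where
  proc : Fin n → Fin k
  tree : Fin k → Fin k → MinTree (Nat.clog 2 n)

namespace DS

variable {k n : ℕ}

/-- Read a number as an event, or as `⊥`. -/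
def toEvent (n m : ℕ) : Option (Fin n) :=
  if h : m < n then some ⟨m, h⟩ else none

/-- The data structure without orderings across processes. -/
def init (proc : Fin n → Fin k) : Timed (DS k n) := do
  tick (n + Nat.clog 2 n + 1)
  let row ← MinTree.build n (Nat.clog 2 n)
  let rows ← alloc k row
  let trees ← alloc k rows
  let trees' ← Timed.foreach (List.finRange k) trees fun T i => do
    let fresh ← alloc k row
    let R ← Timed.foreach (List.finRange k) fresh fun R j => do
      let M ← MinTree.build n (Nat.clog 2 n)
      pure (Function.update R j M)
    pure (Function.update T i R)
  pure ⟨proc, trees'⟩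

/-- The first event of process `j` that is equal to or ordered after `e`. -/
def succ (D : DS k n) (e : Fin n) (j : Fin k) : Timed (Option (Fin n)) := do
  tick 1
  if D.proc e = j then
    pure (some e)
  else
    let m ← (D.tree (D.proc e) j).suffixMin e
    pure (toEvent n m)

/-- The last event of process `i` that is equal to or ordered before `e`. -/
def pred (D : DS k n) (e : Fin n) (i : Fin k) : Timed (Option (Fin n)) := do
  tick 1
  if D.proc e = i then
    pure (some e)
  else
    let m ← (D.tree i (D.proc e)).lastLE e
    pure (m.bind (toEvent n))

/-- Is `a` equal to or ordered before `b`? -/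
def query (D : DS k n) (a b : Fin n) : Timed Bool := do
  tick 1
  if D.proc a = D.proc b then
    pure (decide (a ≤ b))
  else
    let m ← (D.tree (D.proc a) (D.proc b)).suffixMin a
    pure (decide (m ≤ (b : ℕ)))

/-- Record the ordering of the event `f` of process `i` before the event `g` of process `j`
(the charge is for a new `k × k` array of pointers to the trees). -/
def record (D : DS k n) (i j : Fin k) (f g : Fin n) : Timed (DS k n) := do
  tick (k * k + 1)
  let M ← (D.tree i j).lower f g
  pure ⟨D.proc, Function.update D.tree i (Function.update (D.tree i) j M)⟩

/-- Insert the ordering of `a` before `b`, and the orderings that follow by transitivity: for all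
processes `i ≠ j`, the last event of `i` before `a` gets ordered before the first event of `j`
after `b`. -/
def insert (D : DS k n) (a b : Fin n) : Timed (DS k n) :=
  Timed.foreach (List.finRange k) D fun D₁ i => do
    match ← D.pred a i with
    | none => pure D₁
    | some f =>
      Timed.foreach (List.finRange k) D₁ fun D₂ j => do
        match ← D.succ b j with
        | none => pure D₂
        | some g => if i = j then pure D₂ else D₂.record i j f g

end DS

/-! ### The event maps -/

section Maps

variable {k n : ℕ}

/-- The last event before `e` of kind `o` on the location of `e`. -/
def lastBefore (ev : Fin n → Event k) (o : Op) (e : Fin n) : Timed (Option (Fin n)) :=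
  Timed.foreach (List.finRange n) none fun cur f =>
    pure (if f < e ∧ (ev f).op = o ∧ (ev f).loc = (ev e).loc then some f else cur)

/-- `lastBefore o e` for all events `e` of kind `o'`. -/
def lastBeforeAll (ev : Fin n → Event k) (o o' : Op) : Timed (Fin n → Option (Fin n)) := do
  let arr₀ ← alloc n none
  Timed.foreach (List.finRange n) arr₀ fun arr e =>
    if (ev e).op = o' then do
      let f ← lastBefore ev o e
      pure (Function.update arr e f)
    else pure arr

/-- Traverse the trace in the given direction, and store for each event `e` the event selected by
`sel` that was met last in the process of `e`; the event `e` itself counts unless `strict`. -/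
def nearest (ev : Fin n → Event k) (strict : Bool) (order : List (Fin n)) (sel : Fin n → Bool) :
    Timed (Fin n → Option (Fin n)) := do
  let latest₀ ← alloc k none
  let row₀ ← alloc n none
  let res ← Timed.foreach order (latest₀, row₀) fun (latest, row) e =>
    let p := (ev e).proc
    let latest' := if sel e then Function.update latest p (some e) else latest
    pure (latest', Function.update row e (if strict then latest p else latest' p))
  pure res.2

/-- `nearest` for the events of `X` of kind `o` on the location of `a`, for all events `a`. -/
def nearestAll (ev : Fin n → Event k) (X : Fin n → Bool) (order : List (Fin n)) (o : Op) :
    Timed (Fin n → Fin n → Option (Fin n)) := do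
  let row₀ ← alloc n none
  let tab₀ ← alloc n row₀
  Timed.foreach (List.finRange n) tab₀ fun tab a => do
    let row ← nearest ev false order fun e =>
      X e && decide ((ev e).op = o) && decide ((ev e).loc = (ev a).loc)
    pure (Function.update tab a row)

/-- The event maps; `none` stands for `⊥`. At events of `X` all values are in `X` (for `obs` and
`acqOf` because `X` is feasible). -/
structure EventMaps (k n : ℕ) where
  /-- the write observed by a read -/
  obs : Fin n → Option (Fin n)
  /-- the acquire matching a release -/
  acqOf : Fin n → Option (Fin n)
  /-- the release in `X` matching an acquire -/
  relOf : Fin n → Option (Fin n)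
  /-- the flow map: the last read of a process that observes a write -/
  flow : Fin n → Fin k → Option (Fin n)
  /-- the next event of the same process -/
  next : Fin n → Option (Fin n)
  /-- the previous event of the same process -/
  prev : Fin n → Option (Fin n)
  /-- `afterW a e`: first write to the location of `a`, at or after `e` in the process of `e` -/
  afterW : Fin n → Fin n → Option (Fin n)
  /-- `beforeW a e`: last write to the location of `a`, at or before `e` in the process of `e` -/
  beforeW : Fin n → Fin n → Option (Fin n)
  /-- `afterRel a e`: first release of the lock of `a`, at or after `e` in the process of `e` -/
  afterRel : Fin n → Fin n → Option (Fin n)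

/-- Construct the event maps. -/
def buildMaps (ev : Fin n → Event k) (X : Fin n → Bool) : Timed (EventMaps k n) := do
  let obs ← lastBeforeAll ev Op.write Op.read
  let acqOf ← lastBeforeAll ev Op.acq Op.rel
  let relOf₀ ← alloc n none
  let relOf ← Timed.foreach (List.finRange n) relOf₀ fun arr l =>
    pure <| if X l ∧ (ev l).op = Op.rel then
      match acqOf l with
      | none => arr
      | some a => Function.update arr a (some l)
    else arr
  let flow₀ ← alloc n fun (_ : Fin k) => (none : Option (Fin n))
  tick (n * k)
  let flow ← Timed.foreach (List.finRange n) flow₀ fun arr r =>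
    pure <| if X r ∧ (ev r).op = Op.read then
      match obs r with
      | none => arr
      | some w => Function.update arr w (Function.update (arr w) (ev r).proc (some r))
    else arr
  let next ← nearest ev true (List.finRange n).reverse X
  let prev ← nearest ev true (List.finRange n) X
  let afterW ← nearestAll ev X (List.finRange n).reverse Op.write
  let beforeW ← nearestAll ev X (List.finRange n) Op.write
  let afterRel ← nearestAll ev X (List.finRange n).reverse Op.rel
  pure ⟨obs, acqOf, relOf, flow, next, prev, afterW, beforeW, afterRel⟩

end Maps

/-! ### The algorithm `Closure` -/

section Closure

variable {k n : ℕ}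

/-- Push the orderings that the observation rules impose because of `e₁ < e₂`. -/
def obsClosure (ev : Fin n → Event k) (M : EventMaps k n) (Q : List (Fin n × Fin n))
    (e₁ e₂ : Fin n) : Timed (List (Fin n × Fin n)) := do
  tick 1
  let Q₁ ←
    if (ev e₁).op = Op.write then
      match M.afterW e₁ e₂ with
      | none => pure Q
      | some w' =>
        Timed.foreach (List.finRange k) Q fun Q' p =>
          pure <| match M.flow e₁ p with
            | none => Q'
            | some r => (r, w') :: Q'
    else pure Q
  if (ev e₂).op = Op.read then
    match M.beforeW e₂ e₁, M.obs e₂ with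
    | some w', some w => pure (if w' = w then Q₁ else (w', w) :: Q₁)
    | _, _ => pure Q₁
  else pure Q₁

/-- Push the ordering that the lock rule imposes because of `e₁ < e₂`. -/
def lockClosure (ev : Fin n → Event k) (M : EventMaps k n) (Q : List (Fin n × Fin n))
    (e₁ e₂ : Fin n) : Timed (List (Fin n × Fin n)) := do
  tick 1
  if (ev e₁).op = Op.acq then
    match M.relOf e₁, M.afterRel e₁ e₂ with
    | some l₁, some l₂ =>
      match M.acqOf l₂ with
      | some a₂ => pure (if l₁ = l₂ then Q else (l₁, a₂) :: Q)
      | none => pure Q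
    | _, _ => pure Q
  else pure Q

/-- Has the event `g` reached the bound `hi` (where `none` is no bound)? -/
def reached (hi : Option (Fin n)) (g : Fin n) : Bool :=
  match hi with
  | none => false
  | some h => decide (h ≤ g)

/-- Collect the pairs `(f, g')` where `g'` runs through the process of `g`, from `g` on, up to
the bound `hi`. The first argument bounds the number of iterations. -/
def walkUp (M : EventMaps k n) (f : Fin n) (hi : Option (Fin n)) :
    ℕ → Fin n → List (Fin n × Fin n) → Timed (List (Fin n × Fin n))
  | 0, _, acc => pure acc
  | fuel + 1, g, acc => do
    tick 1
    if reached hi g then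
      pure acc
    else
      match M.next g with
      | none => pure ((f, g) :: acc)
      | some g' => walkUp M f hi fuel g' ((f, g) :: acc)

/-- Collect the pairs `(f', g')` not ordered by `D`, where `f'` runs through the process of `f`
from `f` backwards, and `g'` through the process `j` of `g` from `g` on; stop at the first `f'`
without such a pair. The natural number bounds the number of iterations. -/
def walkDown (M : EventMaps k n) (D : DS k n) (j : Fin k) (g : Fin n) :
    ℕ → Fin n → List (Fin n × Fin n) → Timed (List (Fin n × Fin n))
  | 0, _, acc => pure acc
  | fuel + 1, f, acc => do
    tick 1
    let hi ← D.succ f j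
    if reached hi g then
      pure acc
    else
      let acc' ← walkUp M f hi n g acc
      match M.prev f with
      | none => pure acc'
      | some f' => walkDown M D j g fuel f' acc'

/-- The pairs that become ordered when `D` gets the ordering of `a` before `b`. -/
def newPairs (M : EventMaps k n) (D : DS k n) (a b : Fin n) :
    Timed (List (Fin n × Fin n)) :=
  Timed.foreach (List.finRange k) [] fun acc i => do
    match ← D.pred a i with
    | none => pure acc
    | some f =>
      Timed.foreach (List.finRange k) acc fun acc' j => do
        match ← D.succ b j with
        | none => pure acc'
        | some g => if i = j then pure acc' else walkDown M D j g n f acc'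

/-- Apply the closure rules to all the pairs of a list. -/
def applyRules (ev : Fin n → Event k) (M : EventMaps k n) (pairs Q : List (Fin n × Fin n)) :
    Timed (List (Fin n × Fin n)) :=
  Timed.foreach pairs Q fun Q' (e₁, e₂) => do
    let Q₁ ← obsClosure ev M Q' e₁ e₂
    lockClosure ev M Q₁ e₁ e₂

/-- The output of `Closure`: `⊥`, or a data structure. -/
inductive Answer (k n : ℕ)
  | bot
  | order (D : DS k n)

/-- The main loop over the worklist `Q`, cut off (with result `none`) if it has not ended within
the given number of iterations. -/
def closureLoop (ev : Fin n → Event k) (M : EventMaps k n) :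
    ℕ → DS k n → List (Fin n × Fin n) → Timed (Option (Answer k n))
  | 0, _, _ => pure none
  | fuel + 1, D, Q => do
    tick 1
    match Q with
    | [] => pure (some (Answer.order D))
    | (a, b) :: Q' =>
      if ← D.query b a then
        pure (some Answer.bot)
      else if ← D.query a b then
        closureLoop ev M fuel D Q'
      else
        let pairs ← newPairs M D a b
        let D' ← D.insert a b
        let Q'' ← applyRules ev M pairs Q'
        closureLoop ev M fuel D' Q''

/-- The algorithm `Closure`. The input consists of the array of the events of the trace, the
indicator array of `X` and the matrix of the strict order `P`. -/
def closureAlgorithm (fuel : ℕ) (ev : Fin n → Event k) (X : Fin n → Bool) (lt : Fin n → Fin n → Bool) :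
    Timed (Option (Answer k n)) := do
  let M ← buildMaps ev X
  let D₀ ← DS.init fun e => (ev e).proc
  let (D, pairs) ← Timed.foreach (List.finRange n) (D₀, []) fun s e₁ =>
    Timed.foreach (List.finRange n) s fun (D, pairs) e₂ =>
      if lt e₁ e₂ then do
        let D' ← D.insert e₁ e₂
        pure (D', (e₁, e₂) :: pairs)
      else pure (D, pairs)
  let Q ← applyRules ev M pairs []
  closureLoop ev M fuel D Q

open Classical in
/-- The matrix of the strict order of a partial order on `X`. -/
noncomputable def ltMatrix {X : Finset (Fin n)} (P : PartialOrder X) (a b : Fin n) : Bool :=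
  decide (∃ (ha : a ∈ X) (hb : b ∈ X), P.lt ⟨a, ha⟩ ⟨b, hb⟩)

/-- On the input `t`, `X`, `P`, the algorithm `Closure` halts with output `out` after `steps`
steps. -/
def ClosureRuns (t : Trace k n) {X : Finset (Fin n)} (P : PartialOrder X) (out : Answer k n)
    (steps : ℕ) : Prop :=
  ∃ fuel, closureAlgorithm fuel t.ev (fun e => decide (e ∈ X)) (ltMatrix P) = ⟨some out, steps⟩

/-- `D` stores the partial order `Q` on `X`. -/
def DS.Represents (D : DS k n) {X : Finset (Fin n)} (Q : PartialOrder X) : Prop :=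
  ∀ a b : X, (D.query a b).val = true ↔ Q.le a b

/-- The output is correct: a representation of the closure of `P`, or `⊥` if no closed partial
order refines `P`. -/
def CorrectAnswer (t : Trace k n) {X : Finset (Fin n)} (P : PartialOrder X) :
    Answer k n → Prop
  | Answer.bot => ¬ ∃ Q : PartialOrder X, Refines Q P ∧ t.Closed Q
  | Answer.order D => ∃ Q : PartialOrder X, t.IsClosure P Q ∧ D.Represents Q

end Closure

/-! Correctness rests on the invariant `LoopInvariant`. At every moment the structure `D` stores a
partial order that contains `P` and is contained in every closed `R` refining `P`. Every ordering on
the worklist is strict in every such `R`. Every ordering that a rule imposes because of a pair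
ordered in `D` is already in `D` or still on the worklist. If the worklist is empty, `D` satisfies
all the rules, so it is closed (`DS.IsOrder.closed`), and by the invariant it is least. If a popped
`a → b` meets `b ≤ a` in `D`, a closed `R` would have both `a < b` and `b ≤ a`, so none exists.

The rules look only at one event per process: the first or last suitable write or release, or the
last read. This is sound (`Trace.Imposes.sound`) because process order links that event to the pair
that triggers the rule. It is complete because each pair in the hypothesis of a closure condition is
itself among the pairs to which the rules are applied.

An insertion of `a → b` adds the pairs `x ≤ a`, `b ≤ y`. Suffix minima make stored relations closed
downwards on the left and upwards on the right, so one recorded ordering per pair of processes is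
enough (`DS.insert_spec`). If `b ≤ a` fails, the result is again a partial order, and nothing new
arises inside a process (`DS.IsOrder.insert_le_iff`).

For the time bound, a pair becomes ordered at most once, so at most `n ^ 2` pairs do over the whole
run. `newPairs_spec` enumerates the new pairs without repetition in time `O(log n)` per pair, up to
an overhead of `O(log n)` per insertion for fixed `k`. Each new pair pushes at most `k + 2`
orderings. Hence `(k + 3) * D.unordered + Q.length` is a potential that drops by at least one with
every pop (`closureLoop_spec`), and it starts at `O(n ^ 2)`. It bounds the number of iterations and,
multiplied by `O(log n)`, the cost of the loop. The event maps cost `O(n ^ 2)`, and the insertions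
of the pairs of `P` cost `O(n ^ 2 log n)`. -/

/-! ### Values and step counts of timed programs -/

namespace Timed

variable {α β σ : Type}

@[simp] theorem val_bind (m : Timed α) (f : α → Timed β) : (m >>= f).val = (f m.val).val := rfl

@[simp] theorem steps_bind (m : Timed α) (f : α → Timed β) :
    (m >>= f).steps = m.steps + (f m.val).steps := rfl

@[simp] theorem val_pure (a : α) : (pure a : Timed α).val = a := rfl

@[simp] theorem steps_pure (a : α) : (pure a : Timed α).steps = 0 := rfl

@[simp] theorem steps_tick (c : ℕ) : (tick c).steps = c := rfl

@[simp] theorem val_alloc (m : ℕ) (v : α) : (alloc m v).val = fun _ => v := rfl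

@[simp] theorem steps_alloc (m : ℕ) (v : α) : (alloc m v).steps = m + 1 := rfl

@[simp] theorem val_ite (c : Prop) [Decidable c] (x y : Timed α) :
    (if c then x else y).val = if c then x.val else y.val := apply_ite ..

@[simp] theorem steps_ite (c : Prop) [Decidable c] (x y : Timed α) :
    (if c then x else y).steps = if c then x.steps else y.steps := apply_ite ..

@[simp] theorem val_foreach_nil (s : σ) (body : σ → α → Timed σ) :
    (foreach [] s body).val = s := rfl

@[simp] theorem val_foreach_cons (a : α) (l : List α) (s : σ) (body : σ → α → Timed σ) :
    (foreach (a :: l) s body).val = (foreach l (body s a).val body).val := rfl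

@[simp] theorem steps_foreach_nil (s : σ) (body : σ → α → Timed σ) :
    (foreach [] s body).steps = 1 := rfl

@[simp] theorem steps_foreach_cons (a : α) (l : List α) (s : σ) (body : σ → α → Timed σ) :
    (foreach (a :: l) s body).steps =
      1 + ((body s a).steps + (foreach l (body s a).val body).steps) := rfl

theorem val_foreach (l : List α) (s : σ) (body : σ → α → Timed σ) :
    (foreach l s body).val = l.foldl (fun s a => (body s a).val) s := by
  induction l generalizing s with
  | nil => rfl
  | cons a l ih => simp [ih]

theorem steps_foreach_le {l : List α} {s : σ} {body : σ → α → Timed σ} {c : ℕ}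
    (h : ∀ s a, (body s a).steps ≤ c) : (foreach l s body).steps ≤ l.length * (c + 1) + 1 := by
  induction l generalizing s with
  | nil => simp
  | cons a l ih =>
    have h₁ := h s a
    have h₂ := ih (s := (body s a).val)
    simp only [steps_foreach_cons, List.length_cons, add_mul, one_mul] at *
    omega

theorem foreach_induction {l : List α} {s : σ} {body : σ → α → Timed σ} (p : σ → Prop)
    (h₀ : p s) (h : ∀ s, p s → ∀ a ∈ l, p (body s a).val) : p (foreach l s body).val := by
  induction l generalizing s with
  | nil => exact h₀
  | cons a l ih =>
    exact ih (h s h₀ a (by simp)) fun s hs b hb => h s hs b (by simp [hb])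

end Timed

/-! ### Trees of suffix minima -/

namespace MinTree

variable {h : ℕ}

/-- The cell of the array at an index. -/
def entry : {h : ℕ} → MinTree h → ℕ → ℕ
  | _, leaf u, _ => u
  | h + 1, node _ l r, i => if i < 2 ^ h then l.entry i else r.entry (i - 2 ^ h)

/-- Every inner node stores the minimum of the leaves below it. -/
def WF : {h : ℕ} → MinTree h → Prop
  | _, leaf _ => True
  | _, node m l r => m = min l.top r.top ∧ l.WF ∧ r.WF

theorem entry_node_of_lt {m i : ℕ} {l r : MinTree h} (hi : i < 2 ^ h) :
    (node m l r).entry i = l.entry i := by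
  simp [entry, hi]

theorem entry_node_add {m i : ℕ} {l r : MinTree h} :
    (node m l r).entry (i + 2 ^ h) = r.entry i := by
  simp [entry]

theorem exists_lt_two_pow_succ {p : ℕ → Prop} :
    (∃ f < 2 ^ (h + 1), p f) ↔ (∃ f < 2 ^ h, p f) ∨ ∃ f < 2 ^ h, p (f + 2 ^ h) := by
  constructor
  · rintro ⟨f, hf, hp⟩
    rcases lt_or_ge f (2 ^ h) with hl | hl
    · exact Or.inl ⟨f, hl, hp⟩
    · refine Or.inr ⟨f - 2 ^ h, by rw [pow_succ] at hf; omega, ?_⟩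
      rwa [Nat.sub_add_cancel hl]
  · rintro (⟨f, hf, hp⟩ | ⟨f, hf, hp⟩)
    · exact ⟨f, by rw [pow_succ]; omega, hp⟩
    · exact ⟨f + 2 ^ h, by rw [pow_succ]; omega, hp⟩

theorem top_node (m : ℕ) (l r : MinTree h) : (node m l r).top = m := rfl

/-- A minimum is described throughout by the thresholds above it. Each comparison then splits over
the two halves of a node as a disjunction. -/
theorem top_le_iff {t : MinTree h} (ht : t.WF) (v : ℕ) :
    t.top ≤ v ↔ ∃ f < 2 ^ h, t.entry f ≤ v := by
  induction t with
  | leaf u => simp [top, entry]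
  | node m l r ihl ihr =>
    obtain ⟨hm, hl, hr⟩ := ht
    rw [exists_lt_two_pow_succ]
    simp only [top_node, hm, min_le_iff, ihl hl, ihr hr, entry_node_add]
    refine or_congr (exists_congr fun f => and_congr_right fun hf => ?_) Iff.rfl
    rw [entry_node_of_lt hf]

theorem val_build_entry (v f : ℕ) : (build v h).val.entry f = v := by
  induction h generalizing f with
  | zero => rfl
  | succ h ih => simp [build, entry, ih]

theorem val_build_top (v : ℕ) : (build v h).val.top = v := by
  cases h <;> rfl

theorem WF_build (v : ℕ) : (build v h).val.WF := by
  induction h with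
  | zero => trivial
  | succ h ih => exact ⟨by simp [val_build_top], ih, ih⟩

/-- A perfect tree of height `h` has `2 * 2 ^ h - 1` nodes, each charged once; writing the bound
with `+ 1` makes the induction close. -/
theorem steps_build_le (v : ℕ) : (build v h).steps + 1 ≤ 2 * 2 ^ h := by
  induction h with
  | zero => simp [build]
  | succ h ih => simp [build, pow_succ] at *; omega

theorem top_lower (t : MinTree h) (i v : ℕ) : (t.lower i v).val.top = min t.top v := by
  cases t with
  | leaf u => rfl
  | node m l r => simp only [lower, Timed.val_bind, Timed.val_ite]; split_ifs <;> rfl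

theorem WF_lower {t : MinTree h} (ht : t.WF) (i v : ℕ) : (t.lower i v).val.WF := by
  induction t generalizing i with
  | leaf u => trivial
  | node m l r ihl ihr =>
    obtain ⟨hm, hl, hr⟩ := ht
    simp only [lower, Timed.val_bind, Timed.val_ite]
    split_ifs
    · exact ⟨by rw [top_lower, hm]; omega, ihl hl i, hr⟩
    · exact ⟨by rw [top_lower, hm]; omega, hl, ihr hr _⟩

theorem entry_lower (t : MinTree h) {i j : ℕ} (v : ℕ) (hi : i < 2 ^ h) (hj : j < 2 ^ h) :
    (t.lower i v).val.entry j = if j = i then min (t.entry j) v else t.entry j := by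
  induction t generalizing i j with
  | leaf u =>
    simp at hi hj
    simp [lower, entry, hi, hj]
  | @node h m l r ihl ihr =>
    rw [pow_succ] at hi hj
    by_cases h₁ : i < 2 ^ h <;> by_cases h₂ : j < 2 ^ h
    · simp [lower, entry, h₁, h₂, ihl h₁ h₂]
    · have : j ≠ i := by omega
      simp [lower, entry, h₁, h₂, this]
    · have : j ≠ i := by omega
      simp [lower, entry, h₁, h₂, this]
    · have : j - 2 ^ h = i - 2 ^ h ↔ j = i := by omega
      simp [lower, entry, h₁, h₂, ihr (i := i - 2 ^ h) (j := j - 2 ^ h) (by omega) (by omega), this]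

theorem steps_lower (t : MinTree h) (i v : ℕ) : (t.lower i v).steps = h + 1 := by
  induction t generalizing i with
  | leaf u => rfl
  | node m l r ihl ihr => simp [lower, ihl, ihr]; omega

theorem suffixMin_le_iff {t : MinTree h} (ht : t.WF) {i : ℕ} (v : ℕ) (hi : i < 2 ^ h) :
    (t.suffixMin i).val ≤ v ↔ ∃ f < 2 ^ h, i ≤ f ∧ t.entry f ≤ v := by
  induction t generalizing i with
  | leaf u =>
    simp at hi
    simp [suffixMin, entry, hi]
  | @node h m l r ihl ihr =>
    obtain ⟨hm, hl, hr⟩ := ht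
    rw [exists_lt_two_pow_succ]
    rw [pow_succ] at hi
    by_cases h₁ : i < 2 ^ h
    · simp only [suffixMin, Timed.val_bind, h₁, if_true, Timed.val_pure, min_le_iff, ihl hl h₁,
        top_le_iff hr, entry_node_add]
      refine or_congr (exists_congr fun f => and_congr_right fun hf => ?_)
        (exists_congr fun f => and_congr_right fun hf => ?_)
      · rw [entry_node_of_lt hf]
      · exact (and_iff_right (by omega)).symm
    · simp only [suffixMin, Timed.val_bind, h₁, if_false,
        ihr hr (i := i - 2 ^ h) (by omega), entry_node_add]
      rw [or_iff_right]
      · refine exists_congr fun f => and_congr_right fun hf => and_congr_left fun _ => by omega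
      · rintro ⟨f, hf, hif, _⟩
        omega

theorem steps_suffixMin_le (t : MinTree h) (i : ℕ) : (t.suffixMin i).steps ≤ h + 1 := by
  induction t generalizing i with
  | leaf u => rfl
  | @node h m l r ihl ihr =>
    have h₁ := ihl i
    have h₂ := ihr (i - 2 ^ h)
    simp only [suffixMin, Timed.steps_bind, Timed.steps_ite, Timed.steps_tick, Timed.steps_pure]
    split_ifs <;> omega

theorem lastLE_eq_none {t : MinTree h} (ht : t.WF) {v : ℕ} (hv : (t.lastLE v).val = none) :
    ¬ t.top ≤ v := by
  induction t with
  | leaf u => simpa [lastLE, top] using hv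
  | node m l r ihl ihr =>
    obtain ⟨hm, hl, hr⟩ := ht
    simp only [lastLE, Timed.val_bind, Timed.val_ite, Timed.val_pure] at hv
    split_ifs at hv with h₁
    · exact absurd h₁ (ihr hr (by simpa using hv))
    · have := ihl hl hv
      simp only [top_node, hm, min_le_iff]
      tauto

/-- The search goes right exactly when the minimum of the right half is small enough, and every
index on the right exceeds every index on the left. -/
theorem lastLE_eq_some {t : MinTree h} (ht : t.WF) {v f : ℕ} (hv : (t.lastLE v).val = some f) :
    f < 2 ^ h ∧ t.entry f ≤ v ∧ ∀ g < 2 ^ h, t.entry g ≤ v → g ≤ f := by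
  induction t generalizing f with
  | leaf u =>
    simp only [lastLE, Timed.val_bind, Timed.val_pure] at hv
    split_ifs at hv with h₁
    obtain rfl := Option.some.inj hv
    simpa [entry] using h₁
  | @node h m l r ihl ihr =>
    obtain ⟨hm, hl, hr⟩ := ht
    simp only [lastLE, Timed.val_bind, Timed.val_ite, Timed.val_pure] at hv
    split_ifs at hv with h₁
    · obtain ⟨f, hf, rfl⟩ := Option.map_eq_some_iff.1 hv
      obtain ⟨h₂, h₃, h₄⟩ := ihr hr hf
      refine ⟨by rw [pow_succ]; omega, by rwa [entry_node_add], fun g hg hgv => ?_⟩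
      rw [pow_succ] at hg
      rcases lt_or_ge g (2 ^ h) with h₅ | h₅
      · omega
      · have := h₄ (g - 2 ^ h) (by omega) (by simpa [entry, h₅.not_gt] using hgv)
        omega
    · obtain ⟨h₂, h₃, h₄⟩ := ihl hl hv
      refine ⟨by rw [pow_succ]; omega, by rwa [entry_node_of_lt h₂], fun g hg hgv => ?_⟩
      rw [pow_succ] at hg
      rcases lt_or_ge g (2 ^ h) with h₅ | h₅
      · exact h₄ g h₅ (by rwa [entry_node_of_lt h₅] at hgv)
      · exact absurd ((top_le_iff hr v).2
          ⟨g - 2 ^ h, by omega, by simpa [entry, h₅.not_gt] using hgv⟩) h₁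

theorem steps_lastLE_le (t : MinTree h) (v : ℕ) : (t.lastLE v).steps ≤ h + 1 := by
  induction t with
  | leaf u => rfl
  | node m l r ihl ihr =>
    simp only [lastLE, Timed.steps_bind, Timed.steps_ite, Timed.steps_tick, Timed.steps_pure]
    split_ifs <;> omega

end MinTree

/-! ### The order represented by the data structure -/

namespace DS

variable {k n : ℕ} {D : DS k n} {X : Finset (Fin n)}

/-- The order stored by the data structure, as answered by its queries. -/
def le (D : DS k n) (a b : Fin n) : Prop :=
  (D.query a b).val = true

/-- The trees are well-formed, and all recorded orderings are between events of `X` of the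
respective processes. -/
structure WF (D : DS k n) (X : Finset (Fin n)) : Prop where
  tree : ∀ i j, (D.tree i j).WF
  entry : ∀ i j, ∀ f < 2 ^ Nat.clog 2 n, (D.tree i j).entry f < n →
    ∃ a ∈ X, ∃ b ∈ X, D.proc a = i ∧ D.proc b = j ∧ (a : ℕ) = f ∧ (b : ℕ) = (D.tree i j).entry f

theorem lt_two_pow_clog (e : Fin n) : (e : ℕ) < 2 ^ Nat.clog 2 n :=
  e.2.trans_le (Nat.le_pow_clog one_lt_two n)

theorem le_iff_of_proc_eq {a b : Fin n} (h : D.proc a = D.proc b) : D.le a b ↔ a ≤ b := by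
  simp [le, query, h]

theorem le_iff_suffixMin {a b : Fin n} (h : D.proc a ≠ D.proc b) :
    D.le a b ↔ ((D.tree (D.proc a) (D.proc b)).suffixMin a).val ≤ b := by
  simp [le, query, h]

theorem le_iff_of_proc_ne (hD : ∀ i j, (D.tree i j).WF) {a b : Fin n} (h : D.proc a ≠ D.proc b) :
    D.le a b ↔ ∃ f < 2 ^ Nat.clog 2 n, (a : ℕ) ≤ f ∧ (D.tree (D.proc a) (D.proc b)).entry f ≤ b := by
  rw [le_iff_suffixMin h, MinTree.suffixMin_le_iff (hD _ _) _ (lt_two_pow_clog a)]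

theorem le_refl (D : DS k n) (a : Fin n) : D.le a a :=
  (le_iff_of_proc_eq rfl).2 (_root_.le_refl a)

/-- A recorded ordering `f → g` witnesses `a ≤ b` for all `a` at or before `f` and all `b` at or
after `g`. Composition with process order therefore costs nothing, whether or not the whole relation
is transitive. -/
theorem le_mono (hD : ∀ i j, (D.tree i j).WF) {a b x y : Fin n} (hxa : D.proc x = D.proc a)
    (hx : x ≤ a) (hby : D.proc b = D.proc y) (hy : b ≤ y) (h : D.le a b) : D.le x y := by
  by_cases hab : D.proc a = D.proc b
  · rw [le_iff_of_proc_eq hab] at h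
    exact (le_iff_of_proc_eq (hxa.trans (hab.trans hby))).2 (hx.trans (h.trans hy))
  · obtain ⟨f, hf, haf, hfb⟩ := (le_iff_of_proc_ne hD hab).1 h
    refine (le_iff_of_proc_ne hD (by rwa [hxa, ← hby])).2
      ⟨f, hf, (Fin.le_def.1 hx).trans haf, ?_⟩
    rw [hxa, ← hby]
    exact hfb.trans hy

theorem toEvent_eq_some {m : ℕ} {g : Fin n} : toEvent n m = some g ↔ m = g := by
  unfold toEvent
  split_ifs with h
  · simp [Fin.ext_iff]
  · have := g.2
    simp only [false_iff]
    omega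

theorem succ_eq_some (hD : D.WF X) {e g : Fin n} {j : Fin k} (h : (D.succ e j).val = some g) :
    D.proc g = j ∧ D.le e g ∧ (e ∈ X → g ∈ X) := by
  by_cases hj : D.proc e = j
  · obtain rfl : e = g := by simpa [succ, hj] using h
    exact ⟨hj, D.le_refl _, id⟩
  · simp only [succ, Timed.val_bind, hj, if_false, Timed.val_pure,
      toEvent_eq_some] at h
    obtain ⟨f, hf, hef, hfg⟩ :=
      (MinTree.suffixMin_le_iff (hD.tree _ _) _ (lt_two_pow_clog e)).1 h.le
    -- The minimum is attained: the cell `f` has value at most `g`, and `g` is at most every cell of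
    -- the suffix. So `g` is a recorded value, and well-formedness gives its process and its
    -- membership in `X`.
    have hge : (g : ℕ) ≤ (D.tree (D.proc e) j).entry f := h ▸
      (MinTree.suffixMin_le_iff (hD.tree _ _) _ (lt_two_pow_clog e)).2 ⟨f, hf, hef, _root_.le_refl _⟩
    obtain ⟨a, -, b, hb, -, hbj, -, hbf⟩ := hD.entry _ _ f hf (hfg.trans_lt g.2)
    obtain rfl : b = g := Fin.ext (by omega)
    refine ⟨hbj, ?_, fun _ => hb⟩
    rw [le_iff_suffixMin (by rwa [hbj]), hbj]
    exact h.le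

theorem le_iff_succ {e y : Fin n} :
    D.le e y ↔ ∃ g, (D.succ e (D.proc y)).val = some g ∧ g ≤ y := by
  by_cases hj : D.proc e = D.proc y
  · rw [le_iff_of_proc_eq hj]
    simp [succ, hj]
  · rw [le_iff_suffixMin hj]
    simp only [succ, Timed.val_bind, hj, if_false, Timed.val_pure, toEvent_eq_some]
    exact ⟨fun h => ⟨⟨_, h.trans_lt y.2⟩, rfl, h⟩, fun ⟨g, hg, hgy⟩ => hg ▸ hgy⟩

theorem pred_eq_some (hD : D.WF X) {e f : Fin n} {i : Fin k} (h : (D.pred e i).val = some f) :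
    D.proc f = i ∧ D.le f e ∧ (e ∈ X → f ∈ X) := by
  by_cases hj : D.proc e = i
  · obtain rfl : e = f := by simpa [pred, hj] using h
    exact ⟨hj, D.le_refl _, id⟩
  · simp only [pred, Timed.val_bind, hj, if_false, Timed.val_pure,
      Option.bind_eq_some_iff, toEvent_eq_some] at h
    -- The cell that is found has a value at most `e`, hence below `n`: it is a real recorded
    -- ordering and not the default, so its index is an event of `X` in process `i`.
    obtain ⟨m, hm, rfl⟩ := h
    obtain ⟨hm₁, hm₂, -⟩ := MinTree.lastLE_eq_some (hD.tree _ _) hm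
    obtain ⟨a, ha, b, -, hai, -, haf, -⟩ := hD.entry _ _ _ hm₁ (hm₂.trans_lt e.2)
    obtain rfl : a = f := Fin.ext haf
    refine ⟨hai, ?_, fun _ => ha⟩
    rw [le_iff_of_proc_ne hD.tree (by rw [hai]; exact Ne.symm hj), hai]
    exact ⟨a, hm₁, le_rfl, hm₂⟩

theorem le_iff_pred (hD : D.WF X) {x e : Fin n} :
    D.le x e ↔ ∃ f, (D.pred e (D.proc x)).val = some f ∧ x ≤ f := by
  constructor
  · intro h
    by_cases hj : D.proc e = D.proc x
    · rw [le_iff_of_proc_eq hj.symm] at h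
      exact ⟨e, by simp [pred, hj], h⟩
    · obtain ⟨f, hf, hxf, hfe⟩ := (le_iff_of_proc_ne hD.tree (Ne.symm hj)).1 h
      simp only [pred, Timed.val_bind, hj, if_false, Timed.val_pure,
        Option.bind_eq_some_iff, toEvent_eq_some]
      cases hm : ((D.tree (D.proc x) (D.proc e)).lastLE e).val with
      | none =>
        exact absurd ((MinTree.top_le_iff (hD.tree _ _) _).2 ⟨f, hf, hfe⟩)
          (MinTree.lastLE_eq_none (hD.tree _ _) hm)
      | some m =>
        obtain ⟨hm₁, hm₂, hm₃⟩ := MinTree.lastLE_eq_some (hD.tree _ _) hm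
        obtain ⟨a, ha, b, -, hai, -, haf, -⟩ := hD.entry _ _ _ hm₁ (hm₂.trans_lt e.2)
        exact ⟨a, ⟨m, rfl, haf.symm⟩, Fin.le_def.2 (hxf.trans (haf ▸ hm₃ f hf hfe))⟩
  · rintro ⟨f, hf, hxf⟩
    obtain ⟨hf₁, hf₂, -⟩ := pred_eq_some hD hf
    exact le_mono hD.tree hf₁.symm hxf rfl (_root_.le_refl _) hf₂

/-! #### Initialization -/

theorem val_init (proc : Fin n → Fin k) :
    (init proc).val.proc = proc ∧ ∀ i j f, ((init proc).val.tree i j).WF ∧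
      ((init proc).val.tree i j).entry f = n := by
  refine ⟨rfl, ?_⟩
  let p : MinTree (Nat.clog 2 n) → Prop := fun M => M.WF ∧ ∀ f, M.entry f = n
  have hp : p (MinTree.build n (Nat.clog 2 n)).val :=
    ⟨MinTree.WF_build n, MinTree.val_build_entry n⟩
  suffices h : ∀ i j, p ((init proc).val.tree i j) from fun i j f => ⟨(h i j).1, (h i j).2 f⟩
  refine Timed.foreach_induction
    (fun T : Fin k → Fin k → MinTree (Nat.clog 2 n) => ∀ i j, p (T i j)) (fun _ _ => hp) fun T hT i _ => ?_
  simp only [Timed.val_bind, Timed.val_pure]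
  have hR := Timed.foreach_induction (l := List.finRange k)
    (s := fun _ => (MinTree.build n (Nat.clog 2 n)).val)
    (body := fun R j => MinTree.build n (Nat.clog 2 n) >>= fun M => pure (Function.update R j M))
    (fun R => ∀ j, p (R j)) (fun _ => hp) fun R hR j _ j' => by
      simp only [Timed.val_bind, Timed.val_pure, Function.update_apply]
      split_ifs
      exacts [hp, hR j']
  intro i' j'
  rw [Function.update_apply]
  split_ifs
  exacts [hR j', hT i' j']

theorem WF_init (proc : Fin n → Fin k) : (init proc).val.WF X where
  tree i j := ((val_init proc).2 i j 0).1
  entry i j f _ h := absurd h (by rw [((val_init proc).2 i j f).2]; exact lt_irrefl n)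

theorem init_le_iff {proc : Fin n → Fin k} {a b : Fin n} :
    (init proc).val.le a b ↔ proc a = proc b ∧ a ≤ b := by
  by_cases h : proc a = proc b
  · rw [le_iff_of_proc_eq h]
    exact (and_iff_right h).symm
  · rw [le_iff_of_proc_ne (WF_init (X := ∅) proc).tree h]
    refine iff_of_false ?_ (fun h' => h h'.1)
    rintro ⟨f, _, _, h₁⟩
    rw [((val_init proc).2 _ _ f).2] at h₁
    exact absurd h₁ b.2.not_ge

/-! #### Insertion -/

theorem WF_record (hD : D.WF X) {i j : Fin k} {f g : Fin n} (hf : D.proc f = i) (hg : D.proc g = j)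
    (hfX : f ∈ X) (hgX : g ∈ X) : (D.record i j f g).val.WF X := by
  have htree : ∀ i' j', (D.record i j f g).val.tree i' j' =
      if i' = i ∧ j' = j then ((D.tree i j).lower f g).val else D.tree i' j' := by
    intro i' j'
    simp only [record, Timed.val_bind, Timed.val_pure, Function.update_apply]
    split_ifs <;> simp_all
  constructor
  · intro i' j'
    rw [htree]
    split_ifs
    exacts [MinTree.WF_lower (hD.tree _ _) _ _, hD.tree _ _]
  · intro i' j' e he
    change _ → ∃ a ∈ X, ∃ b ∈ X, D.proc a = i' ∧ D.proc b = j' ∧ _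
    rw [htree]
    split_ifs with h
    · obtain ⟨rfl, rfl⟩ := h
      rw [MinTree.entry_lower _ _ (lt_two_pow_clog f) he]
      split_ifs with h₁
      · intro h₂
        rcases le_total (g : ℕ) ((D.tree i' j').entry e) with h₃ | h₃
        · exact ⟨f, hfX, g, hgX, hf, hg, h₁.symm, (min_eq_right h₃).symm⟩
        · rw [min_eq_left h₃] at h₂ ⊢
          exact hD.entry _ _ e he h₂
      · exact hD.entry _ _ e he
    · exact hD.entry _ _ e he

/-- Lowering one cell adds a whole rectangle: the events of `i` up to `f` against the events of `j`
from `g` on. -/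
theorem record_le_iff (hD : D.WF X) {i j : Fin k} {f g x y : Fin n} (hij : i ≠ j) (hf : D.proc f = i)
    (hg : D.proc g = j) (hfX : f ∈ X) (hgX : g ∈ X) : (D.record i j f g).val.le x y ↔
      D.le x y ∨ (D.proc x = i ∧ D.proc y = j ∧ x ≤ f ∧ g ≤ y) := by
  by_cases hxy : D.proc x = D.proc y
  · rw [le_iff_of_proc_eq hxy, le_iff_of_proc_eq (D := (D.record i j f g).val) hxy]
    refine (or_iff_left ?_).symm
    rintro ⟨rfl, rfl, -⟩
    exact hij hxy
  rw [le_iff_of_proc_ne hD.tree hxy, le_iff_of_proc_ne (WF_record hD hf hg hfX hgX).tree hxy]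
  change (∃ e < _, _ ∧ ((Function.update D.tree i _) (D.proc x) (D.proc y)).entry e ≤ _) ↔ _
  by_cases h : D.proc x = i ∧ D.proc y = j
  · obtain ⟨rfl, rfl⟩ := h
    simp only [Function.update_self, true_and]
    constructor
    · rintro ⟨e, he, hxe, hey⟩
      rw [MinTree.entry_lower _ _ (lt_two_pow_clog f) he] at hey
      split_ifs at hey with h₁
      · rcases min_le_iff.1 hey with h₂ | h₂
        exacts [Or.inl ⟨e, he, hxe, h₂⟩, Or.inr ⟨Fin.le_def.2 (h₁ ▸ hxe), h₂⟩]
      · exact Or.inl ⟨e, he, hxe, hey⟩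
    · rintro (⟨e, he, hxe, hey⟩ | ⟨hxf, hgy⟩)
      · refine ⟨e, he, hxe, ?_⟩
        rw [MinTree.entry_lower _ _ (lt_two_pow_clog f) he]
        split_ifs
        exacts [min_le_iff.2 (Or.inl hey), hey]
      · refine ⟨f, lt_two_pow_clog f, hxf, ?_⟩
        rw [MinTree.entry_lower _ _ (lt_two_pow_clog f) (lt_two_pow_clog f), if_pos rfl]
        exact min_le_iff.2 (Or.inr hgy)
  · have htree : ∀ M, Function.update D.tree i (Function.update (D.tree i) j M) (D.proc x) (D.proc y) =
        D.tree (D.proc x) (D.proc y) := by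
      intro M
      simp only [Function.update_apply]
      split_ifs <;> simp_all
    rw [htree, or_iff_left]
    exact fun h' => h ⟨h'.1, h'.2.1⟩

/-- The inner loop of `insert`. -/
def insertRow (D : DS k n) (b : Fin n) (i : Fin k) (f : Fin n) (l : List (Fin k)) (D₁ : DS k n) :
    Timed (DS k n) :=
  Timed.foreach l D₁ fun D₂ j => do
    match ← D.succ b j with
    | none => pure D₂
    | some g => if i = j then pure D₂ else D₂.record i j f g

/-- Successors are looked up in the old structure `D`, while orderings are recorded in the growing
`D₁`. Only the processes of the two need to agree, so the contributions of the columns in `l` are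
independent of each other. -/
theorem insertRow_spec (hD : D.WF X) {b f : Fin n} (hb : b ∈ X) (hf : f ∈ X) {l : List (Fin k)}
    {D₁ : DS k n} (hD₁ : D₁.WF X) (hp : D₁.proc = D.proc) :
    (insertRow D b (D.proc f) f l D₁).val.WF X ∧
      (insertRow D b (D.proc f) f l D₁).val.proc = D.proc ∧
      ∀ x y, (insertRow D b (D.proc f) f l D₁).val.le x y ↔ D₁.le x y ∨
        (D.proc x = D.proc f ∧ D.proc y ∈ l ∧ D.proc x ≠ D.proc y ∧ x ≤ f ∧ D.le b y) := by
  unfold insertRow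
  induction l generalizing D₁ with
  | nil => simp [hD₁, hp]
  | cons j l ih =>
    simp only [Timed.val_foreach_cons, Timed.val_bind]
    cases hg : (D.succ b j).val with
    | none =>
      obtain ⟨h₁, h₂, h₃⟩ := ih hD₁ hp
      refine ⟨h₁, h₂, fun x y => (h₃ x y).trans ?_⟩
      -- No successor in process `j` means that no event of `j` lies above `b`, so this column adds
      -- an empty rectangle.
      have : D.proc y = j → ¬ D.le b y := by
        rintro rfl h
        obtain ⟨g, hg', -⟩ := le_iff_succ.1 h
        simp [hg] at hg'
      simp only [List.mem_cons]
      tauto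
    | some g =>
      obtain ⟨hgj, hbg, hgX⟩ := succ_eq_some hD hg
      by_cases hij : D.proc f = j
      · simp only [hij, if_true]
        simp only [hij] at ih
        obtain ⟨h₁, h₂, h₃⟩ := ih hD₁ hp
        refine ⟨h₁, h₂, fun x y => (h₃ x y).trans ?_⟩
        simp only [List.mem_cons]
        grind
      · simp only [hij, if_false]
        obtain ⟨h₁, h₂, h₃⟩ := ih (D₁ := (D₁.record (D.proc f) j f g).val)
          (WF_record hD₁ (by rw [hp]) (by rw [hp, hgj]) hf (hgX hb)) hp
        refine ⟨h₁, h₂, fun x y => (h₃ x y).trans ?_⟩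
        rw [record_le_iff hD₁ hij (by rw [hp]) (by rw [hp, hgj]) hf (hgX hb), hp]
        have : D.proc y = j → (D.le b y ↔ g ≤ y) := by
          rintro rfl
          rw [le_iff_succ]
          simp [hg]
        simp only [List.mem_cons]
        grind

theorem insert_eq (D : DS k n) (a b : Fin n) :
    D.insert a b = (Timed.foreach (List.finRange k) D fun D₁ i => do
      match ← D.pred a i with
      | none => pure D₁
      | some f => insertRow D b i f (List.finRange k) D₁) := rfl

/-- The down-set of `a` in process `i` ends at its predecessor `f`, and the up-set of `b` in process
`j` starts at its successor `g`. The rectangles of these pairs make up all the cross-process pairs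
to be added. -/
theorem insert_spec (hD : D.WF X) {a b : Fin n} (ha : a ∈ X) (hb : b ∈ X) :
    (D.insert a b).val.WF X ∧ (D.insert a b).val.proc = D.proc ∧
      ∀ x y, (D.insert a b).val.le x y ↔
        D.le x y ∨ (D.proc x ≠ D.proc y ∧ D.le x a ∧ D.le b y) := by
  suffices h : ∀ (l : List (Fin k)) (D₁ : DS k n), D₁.WF X → D₁.proc = D.proc →
      let D' := (Timed.foreach l D₁ fun D₁ i => do
        match ← D.pred a i with
        | none => pure D₁
        | some f => insertRow D b i f (List.finRange k) D₁).val
      D'.WF X ∧ D'.proc = D.proc ∧ ∀ x y, D'.le x y ↔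
        D₁.le x y ∨ (D.proc x ∈ l ∧ D.proc x ≠ D.proc y ∧ D.le x a ∧ D.le b y) by
    have := h (List.finRange k) D hD rfl
    simpa [insert_eq] using this
  intro l
  induction l with
  | nil => intro D₁ hD₁ hp; simp [hD₁, hp]
  | cons i l ih =>
    intro D₁ hD₁ hp
    simp only [Timed.val_foreach_cons, Timed.val_bind]
    cases hf : (D.pred a i).val with
    | none =>
      obtain ⟨h₁, h₂, h₃⟩ := ih D₁ hD₁ hp
      refine ⟨h₁, h₂, fun x y => (h₃ x y).trans ?_⟩
      have : D.proc x = i → ¬ D.le x a := by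
        rintro rfl h
        obtain ⟨g, hg', -⟩ := (le_iff_pred hD).1 h
        simp [hf] at hg'
      simp only [List.mem_cons]
      tauto
    | some f =>
      obtain ⟨rfl, hfa, hfX⟩ := pred_eq_some hD hf
      obtain ⟨r₁, r₂, r₃⟩ := insertRow_spec hD hb (hfX ha) (l := List.finRange k) hD₁ hp
      obtain ⟨h₁, h₂, h₃⟩ := ih _ r₁ r₂
      refine ⟨h₁, h₂, fun x y => (h₃ x y).trans ?_⟩
      rw [r₃]
      have : D.proc x = D.proc f → (D.le x a ↔ x ≤ f) := by
        intro h
        rw [le_iff_pred hD, h]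
        simp [hf]
      simp only [List.mem_cons, List.mem_finRange, true_and]
      tauto

/-! #### Step counts -/

theorem steps_succ_le (D : DS k n) (e : Fin n) (j : Fin k) :
    (D.succ e j).steps ≤ Nat.clog 2 n + 2 := by
  have := MinTree.steps_suffixMin_le (D.tree (D.proc e) j) e
  simp only [succ, Timed.steps_bind, Timed.steps_ite, Timed.steps_tick, Timed.steps_pure]
  split_ifs <;> omega

theorem steps_pred_le (D : DS k n) (e : Fin n) (i : Fin k) :
    (D.pred e i).steps ≤ Nat.clog 2 n + 2 := by
  have := MinTree.steps_lastLE_le (D.tree i (D.proc e)) e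
  simp only [pred, Timed.steps_bind, Timed.steps_ite, Timed.steps_tick, Timed.steps_pure]
  split_ifs <;> omega

theorem steps_query_le (D : DS k n) (a b : Fin n) : (D.query a b).steps ≤ Nat.clog 2 n + 2 := by
  have := MinTree.steps_suffixMin_le (D.tree (D.proc a) (D.proc b)) a
  simp only [query, Timed.steps_bind, Timed.steps_ite, Timed.steps_tick, Timed.steps_pure]
  split_ifs <;> omega

theorem steps_record (D : DS k n) (i j : Fin k) (f g : Fin n) :
    (D.record i j f g).steps = k * k + 1 + (Nat.clog 2 n + 1) := by
  simp [record, MinTree.steps_lower]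

theorem steps_insertRow_le (D : DS k n) (b : Fin n) (i : Fin k) (f : Fin n) (D₁ : DS k n) :
    (insertRow D b i f (List.finRange k) D₁).steps ≤
      k * (k * k + 2 * Nat.clog 2 n + 5) + 1 := by
  refine (Timed.steps_foreach_le (c := k * k + 2 * Nat.clog 2 n + 4) fun D₂ j => ?_).trans
    (by simp)
  have := steps_succ_le D b j
  simp only [Timed.steps_bind]
  cases (D.succ b j).val with
  | none => simp only [Timed.steps_pure]; omega
  | some g =>
    simp only [Timed.steps_ite, Timed.steps_pure, steps_record]
    split_ifs <;> omega

theorem steps_insert_le (D : DS k n) (a b : Fin n) :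
    (D.insert a b).steps ≤
      k * (Nat.clog 2 n + 4 + k * (k * k + 2 * Nat.clog 2 n + 5)) + 1 := by
  rw [insert_eq]
  refine (Timed.steps_foreach_le (c := Nat.clog 2 n + 3 + k * (k * k + 2 * Nat.clog 2 n + 5))
    fun D₁ i => ?_).trans (by simp; apply le_of_eq; ring)
  have := steps_pred_le D a i
  simp only [Timed.steps_bind]
  cases (D.pred a i).val with
  | none => simp only [Timed.steps_pure]; omega
  | some f =>
    have := steps_insertRow_le D b i f D₁
    simp only
    omega

theorem steps_init_le (proc : Fin n → Fin k) :
    (init proc).steps ≤ n + Nat.clog 2 n + 2 * 2 ^ Nat.clog 2 n + k + k + 4 +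
      k * (k + 3 + k * (2 * 2 ^ Nat.clog 2 n + 1)) := by
  have hb := MinTree.steps_build_le (h := Nat.clog 2 n) n
  simp only [init, Timed.steps_bind, Timed.steps_tick, Timed.steps_alloc, Timed.steps_pure,
    Timed.val_alloc]
  have hrow : ∀ R : Fin k → MinTree (Nat.clog 2 n),
      (Timed.foreach (List.finRange k) R fun R j => do
        let M ← MinTree.build n (Nat.clog 2 n)
        pure (Function.update R j M)).steps ≤ k * (2 * 2 ^ Nat.clog 2 n + 1) + 1 := by
    intro R
    refine (Timed.steps_foreach_le (c := 2 * 2 ^ Nat.clog 2 n) fun R j => ?_).trans (by simp)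
    simp only [Timed.steps_bind, Timed.steps_pure]
    omega
  have hall : ∀ T : Fin k → Fin k → MinTree (Nat.clog 2 n),
      (Timed.foreach (List.finRange k) T fun T i => do
        let fresh ← alloc k (MinTree.build n (Nat.clog 2 n)).val
        let R ← Timed.foreach (List.finRange k) fresh fun R j => do
          let M ← MinTree.build n (Nat.clog 2 n)
          pure (Function.update R j M)
        pure (Function.update T i R)).steps ≤
          k * (k + 3 + k * (2 * 2 ^ Nat.clog 2 n + 1)) + 1 := by
    intro T
    refine (Timed.steps_foreach_le (c := k + 2 + k * (2 * 2 ^ Nat.clog 2 n + 1))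
      fun T i => ?_).trans (by simp; apply le_of_eq; ring)
    have := hrow fun _ => (MinTree.build n (Nat.clog 2 n)).val
    simp only [Timed.steps_bind, Timed.steps_pure, Timed.steps_alloc, Timed.val_alloc]
    omega
  have : ∀ m ≤ k * (k + 3 + k * (2 * 2 ^ Nat.clog 2 n + 1)) + 1,
      n + Nat.clog 2 n + 1 + ((MinTree.build n (Nat.clog 2 n)).steps + (k + 1 + (k + 1 + (m + 0)))) ≤
        n + Nat.clog 2 n + 2 * 2 ^ Nat.clog 2 n + k + k + 4 +
          k * (k + 3 + k * (2 * 2 ^ Nat.clog 2 n + 1)) := fun m hm => by omega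
  exact this _ (hall fun _ _ => (MinTree.build n (Nat.clog 2 n)).val)

end DS

/-! ### Correctness of the event maps -/

/-- The option is the last element, in the order `R`, that satisfies `p`. -/
def IsLast {α : Type} (R : α → α → Prop) (p : α → Prop) : Option α → Prop
  | none => ∀ g, ¬ p g
  | some f => p f ∧ ∀ g, p g → g = f ∨ R g f

namespace IsLast

variable {α : Type} {R : α → α → Prop} {p q : α → Prop} {o : Option α}

theorem congr (h : IsLast R p o) (hpq : ∀ a, p a ↔ q a) : IsLast R q o := by
  rwa [show q = p from funext fun a => propext (hpq a).symm]

theorem of_eq_some {f : α} (h : IsLast R p o) (ho : o = some f) :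
    p f ∧ ∀ g, p g → g = f ∨ R g f := by
  rwa [ho] at h

theorem of_eq_none (h : IsLast R p o) (ho : o = none) (g : α) : ¬ p g := by
  rw [ho] at h
  exact h g

theorem exists_of (h : IsLast R p o) {g : α} (hg : p g) :
    ∃ f, o = some f ∧ p f ∧ (g = f ∨ R g f) := by
  cases o with
  | none => exact absurd hg (h g)
  | some f => exact ⟨f, rfl, h.1, h.2 g hg⟩

theorem append {l : List α} {a : α} (h : IsLast R (fun g => g ∈ l ∧ q g) o)
    (ha : ∀ g ∈ l, R g a) [Decidable (q a)] :
    IsLast R (fun g => g ∈ l ++ [a] ∧ q g) (if q a then some a else o) := by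
  split_ifs with hq
  · refine ⟨⟨by simp, hq⟩, fun g hg => ?_⟩
    rcases List.mem_append.1 hg.1 with h' | h'
    exacts [Or.inr (ha g h'), Or.inl (List.mem_singleton.1 h')]
  · refine h.congr fun g => ?_
    simp only [List.mem_append, List.mem_singleton]
    constructor
    · exact fun h => ⟨Or.inl h.1, h.2⟩
    · rintro ⟨h' | rfl, hg⟩
      exacts [⟨h', hg⟩, absurd hg hq]

theorem foldl {l : List α} (hl : l.Pairwise R) (p : α → Prop) [DecidablePred p] :
    IsLast R (fun a => a ∈ l ∧ p a) (l.foldl (fun cur a => if p a then some a else cur) none) := by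
  induction l using List.reverseRecOn with
  | nil => intro g; simp
  | append_singleton l a ih =>
    rw [List.pairwise_append] at hl
    rw [List.foldl_append]
    exact (ih hl.1).append fun g hg => hl.2.2 g hg a (by simp)

theorem foldl_finRange {n : ℕ} (p : Fin n → Prop) [DecidablePred p] :
    IsLast (· < ·) p ((List.finRange n).foldl (fun cur a => if p a then some a else cur) none) :=
  (foldl (List.pairwise_lt_finRange n) p).congr fun a => by simp

end IsLast

theorem List.foldl_ite_update_apply {α β : Type} [DecidableEq α] (c : α → Prop) [DecidablePred c]
    (v : α → β) (l : List α) (f : α → β) (e : α) :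
    l.foldl (fun f a => if c a then Function.update f a (v a) else f) f e =
      if e ∈ l ∧ c e then v e else f e := by
  induction l using List.reverseRecOn with
  | nil => simp
  | append_singleton l a ih =>
    simp only [List.foldl_append, List.foldl_cons, List.foldl_nil, List.mem_append,
      List.mem_singleton]
    split_ifs <;> simp only [Function.update_apply, ih] <;> grind

theorem List.foldl_update_apply {α β : Type} [DecidableEq α] (v : α → β) (l : List α) (f : α → β)
    {e : α} (he : e ∈ l) : l.foldl (fun f a => Function.update f a (v a)) f e = v e := by
  have := List.foldl_ite_update_apply (fun _ => True) v l f e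
  simpa [he] using this

section Maps

variable {k n : ℕ}

theorem lastBefore_isLast (ev : Fin n → Event k) (o : Op) (e : Fin n) :
    IsLast (· < ·) (fun f => f < e ∧ (ev f).op = o ∧ (ev f).loc = (ev e).loc)
      (lastBefore ev o e).val := by
  rw [lastBefore, Timed.val_foreach]
  exact IsLast.foldl_finRange _

theorem val_lastBeforeAll (ev : Fin n → Event k) (o o' : Op) {e : Fin n} (he : (ev e).op = o') :
    (lastBeforeAll ev o o').val e = (lastBefore ev o e).val := by
  simp only [lastBeforeAll, Timed.val_bind, Timed.val_foreach, Timed.val_ite, Timed.val_pure]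
  rw [List.foldl_ite_update_apply (fun e => (ev e).op = o')]
  simp [he]

/-- The traversal order `R` is abstract, so that one induction serves the forward scan (`<`) and the
backward scan (`>`). Asymmetry of `R` makes the visited events distinct, so a cell of the row is
final once it has been written. -/
theorem nearest_isLast (ev : Fin n → Event k) (strict : Bool) {order : List (Fin n)}
    (sel : Fin n → Bool) {R : Fin n → Fin n → Prop} (hl : order.Pairwise R)
    (hR : ∀ a b, R a b → ¬ R b a) {e : Fin n} (he : e ∈ order) :
    IsLast R (fun g => g ∈ order ∧ sel g ∧ (ev g).proc = (ev e).proc ∧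
      (R g e ∨ (strict = false ∧ g = e))) ((nearest ev strict order sel).val e) := by
  let step : (Fin k → Option (Fin n)) × (Fin n → Option (Fin n)) → Fin n →
      (Fin k → Option (Fin n)) × (Fin n → Option (Fin n)) := fun s e =>
    (if sel e then Function.update s.1 (ev e).proc (some e) else s.1,
      Function.update s.2 e (if strict then s.1 (ev e).proc
        else (if sel e then Function.update s.1 (ev e).proc (some e) else s.1) (ev e).proc))
  -- The induction appends the next visited event at the end and carries both components of the
  -- state: the latest selected event of each process, and the finished cells of the row.
  have key : ∀ l : List (Fin n), l.Pairwise R →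
      (∀ p, IsLast R (fun g => g ∈ l ∧ sel g ∧ (ev g).proc = p)
        ((l.foldl step (fun _ => none, fun _ => none)).1 p)) ∧
      ∀ e ∈ l, IsLast R (fun g => g ∈ l ∧ sel g ∧ (ev g).proc = (ev e).proc ∧
        (R g e ∨ (strict = false ∧ g = e))) ((l.foldl step (fun _ => none, fun _ => none)).2 e) := by
    intro l hl
    induction l using List.reverseRecOn with
    | nil => exact ⟨fun p g => by simp, by simp⟩
    | append_singleton l a ih =>
      rw [List.pairwise_append] at hl
      have hla : ∀ g ∈ l, R g a := fun g hg => hl.2.2 g hg a (by simp)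
      obtain ⟨ih₁, ih₂⟩ := ih hl.1
      have hirr : ¬ R a a := fun h => hR a a h h
      have hal : a ∉ l := fun h => hirr (hla a h)
      have hlatest : ∀ p, IsLast R (fun g => g ∈ l ++ [a] ∧ sel g ∧ (ev g).proc = p)
          (((l ++ [a]).foldl step (fun _ => none, fun _ => none)).1 p) := by
        intro p
        have := (ih₁ p).append hla
        simp only [List.foldl_append, List.foldl_cons, List.foldl_nil, step]
        convert this using 1
        simp only [Function.update_apply, apply_ite (fun f : Fin k → Option (Fin n) => f p)]
        grind
      refine ⟨hlatest, fun e he => ?_⟩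
      rcases List.mem_append.1 he with he | he
      · have hea : e ≠ a := fun h => hal (h ▸ he)
        have hRe : ¬ R a e := hR e a (hla e he)
        simp only [List.foldl_append, List.foldl_cons, List.foldl_nil, step,
          Function.update_of_ne hea]
        refine (ih₂ e he).congr fun g => ?_
        simp only [List.mem_append, List.mem_singleton]
        constructor
        · exact fun h => ⟨Or.inl h.1, h.2⟩
        · rintro ⟨h | rfl, h'⟩
          · exact ⟨h, h'⟩
          · rcases h'.2.2 with h'' | h''
            exacts [absurd h'' hRe, absurd h''.2.symm hea]
      · obtain rfl := List.mem_singleton.1 he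
        cases strict with
        | false =>
          have := hlatest (ev e).proc
          simp only [List.foldl_append, List.foldl_cons, List.foldl_nil, step,
            Function.update_self] at this ⊢
          refine this.congr fun g => ?_
          simp only [List.mem_append, List.mem_singleton]
          have := hla g
          tauto
        | true =>
          simp only [List.foldl_append, List.foldl_cons, List.foldl_nil, step,
            Function.update_self]
          refine (ih₁ (ev e).proc).congr fun g => ?_
          simp only [List.mem_append, List.mem_singleton]
          have := hla g
          grind
  have : (nearest ev strict order sel).val =
      (order.foldl step (fun _ => none, fun _ => none)).2 := by
    simp only [nearest, Timed.val_bind, Timed.val_foreach, Timed.val_pure, Timed.val_alloc]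
    rfl
  rw [this]
  exact (key order hl).2 e he

theorem nearest_finRange_isLast (ev : Fin n → Event k) (strict : Bool) (sel : Fin n → Bool)
    (e : Fin n) : IsLast (· < ·) (fun g => sel g ∧ (ev g).proc = (ev e).proc ∧
      (g < e ∨ (strict = false ∧ g = e))) ((nearest ev strict (List.finRange n) sel).val e) :=
  (nearest_isLast ev strict sel (List.pairwise_lt_finRange n) (fun _ _ => lt_asymm)
    (List.mem_finRange e)).congr fun a => by simp

theorem nearest_finRange_reverse_isLast (ev : Fin n → Event k) (strict : Bool)
    (sel : Fin n → Bool) (e : Fin n) :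
    IsLast (· > ·) (fun g => sel g ∧ (ev g).proc = (ev e).proc ∧
      (e < g ∨ (strict = false ∧ g = e)))
      ((nearest ev strict (List.finRange n).reverse sel).val e) :=
  (nearest_isLast ev strict sel (R := (· > ·))
    (List.pairwise_reverse.2 (List.pairwise_lt_finRange n)) (fun _ _ => lt_asymm)
    (List.mem_reverse.2 (List.mem_finRange e))).congr fun a => by simp

theorem val_nearestAll (ev : Fin n → Event k) (X : Fin n → Bool) (order : List (Fin n)) (o : Op)
    (a : Fin n) : (nearestAll ev X order o).val a = (nearest ev false order fun e =>
      X e && decide ((ev e).op = o) && decide ((ev e).loc = (ev a).loc)).val := by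
  simp only [nearestAll, Timed.val_bind, Timed.val_foreach, Timed.val_pure, Timed.val_alloc]
  exact List.foldl_update_apply (fun a => (nearest ev false order fun e =>
      X e && decide ((ev e).op = o) && decide ((ev e).loc = (ev a).loc)).val) _ _
      (List.mem_finRange a)

/-- The event maps have the values described in `EventMaps`. -/
structure EventMaps.Correct (M : EventMaps k n) (ev : Fin n → Event k) (X : Fin n → Bool) :
    Prop where
  obs : ∀ r, (ev r).op = Op.read → IsLast (· < ·)
    (fun w => w < r ∧ (ev w).op = Op.write ∧ (ev w).loc = (ev r).loc) (M.obs r)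
  acqOf : ∀ l, (ev l).op = Op.rel → IsLast (· < ·)
    (fun a => a < l ∧ (ev a).op = Op.acq ∧ (ev a).loc = (ev l).loc) (M.acqOf l)
  relOf : ∀ a, IsLast (· < ·)
    (fun l => X l ∧ (ev l).op = Op.rel ∧ M.acqOf l = some a) (M.relOf a)
  flow : ∀ w p, IsLast (· < ·)
    (fun r => X r ∧ (ev r).op = Op.read ∧ M.obs r = some w ∧ (ev r).proc = p) (M.flow w p)
  next : ∀ e, IsLast (· > ·) (fun g => X g ∧ (ev g).proc = (ev e).proc ∧ e < g) (M.next e)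
  prev : ∀ e, IsLast (· < ·) (fun g => X g ∧ (ev g).proc = (ev e).proc ∧ g < e) (M.prev e)
  afterW : ∀ a e, IsLast (· > ·) (fun g => X g ∧ (ev g).op = Op.write ∧
    (ev g).loc = (ev a).loc ∧ (ev g).proc = (ev e).proc ∧ e ≤ g) (M.afterW a e)
  beforeW : ∀ a e, IsLast (· < ·) (fun g => X g ∧ (ev g).op = Op.write ∧
    (ev g).loc = (ev a).loc ∧ (ev g).proc = (ev e).proc ∧ g ≤ e) (M.beforeW a e)
  afterRel : ∀ a e, IsLast (· > ·) (fun g => X g ∧ (ev g).op = Op.rel ∧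
    (ev g).loc = (ev a).loc ∧ (ev g).proc = (ev e).proc ∧ e ≤ g) (M.afterRel a e)

theorem buildMaps_correct (ev : Fin n → Event k) (X : Fin n → Bool) :
    (buildMaps ev X).val.Correct ev X where
  obs r hr := by
    change IsLast _ _ ((lastBeforeAll ev Op.write Op.read).val r)
    rw [val_lastBeforeAll ev _ _ hr]
    exact lastBefore_isLast ev _ r
  acqOf l hl := by
    change IsLast _ _ ((lastBeforeAll ev Op.acq Op.rel).val l)
    rw [val_lastBeforeAll ev _ _ hl]
    exact lastBefore_isLast ev _ l
  relOf a := by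
    have h : (buildMaps ev X).val.relOf a = (List.finRange n).foldl (fun cur l =>
        if X l ∧ (ev l).op = Op.rel ∧ (buildMaps ev X).val.acqOf l = some a
        then some l else cur) none := by
      simp only [buildMaps, Timed.val_bind, Timed.val_foreach, Timed.val_pure, Timed.val_alloc]
      -- Reading one fixed cell commutes with every iteration, so the fold over arrays becomes a
      -- fold over the values of that cell.
      refine (List.foldl_hom (fun f : Fin n → Option (Fin n) => f a) fun f l => ?_).symm
      cases h : (lastBeforeAll ev Op.acq Op.rel).val l with
      | none => simp
      | some b =>
        by_cases h₁ : X l <;> by_cases h₂ : (ev l).op = Op.rel <;>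
          simp [h₁, h₂, Function.update_apply, eq_comm]
    rw [h]
    exact IsLast.foldl_finRange _
  flow w p := by
    have h : (buildMaps ev X).val.flow w p = (List.finRange n).foldl (fun cur r =>
        if X r ∧ (ev r).op = Op.read ∧ (buildMaps ev X).val.obs r = some w ∧ (ev r).proc = p
        then some r else cur) none := by
      simp only [buildMaps, Timed.val_bind, Timed.val_foreach, Timed.val_pure, Timed.val_alloc]
      refine (List.foldl_hom (fun f : Fin n → Fin k → Option (Fin n) => f w p) fun f r => ?_).symm
      cases h : (lastBeforeAll ev Op.write Op.read).val r with
      | none => simp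
      | some b =>
        by_cases h₁ : X r <;> by_cases h₂ : (ev r).op = Op.read <;>
          by_cases h₃ : w = b <;> simp [h₁, h₂, h₃, Function.update_apply, eq_comm]
    rw [h]
    exact IsLast.foldl_finRange _
  next e := (nearest_finRange_reverse_isLast ev true X e).congr fun g => by simp
  prev e := (nearest_finRange_isLast ev true X e).congr fun g => by simp
  afterW a e := by
    change IsLast _ _ ((nearestAll ev X _ Op.write).val a e)
    rw [val_nearestAll]
    refine (nearest_finRange_reverse_isLast ev false _ e).congr fun g => ?_
    simp only [Bool.and_eq_true, decide_eq_true_eq, le_iff_lt_or_eq, true_and, @eq_comm _ e g, and_assoc]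
  beforeW a e := by
    change IsLast _ _ ((nearestAll ev X _ Op.write).val a e)
    rw [val_nearestAll]
    refine (nearest_finRange_isLast ev false _ e).congr fun g => ?_
    simp only [Bool.and_eq_true, decide_eq_true_eq, le_iff_lt_or_eq, true_and, and_assoc]
  afterRel a e := by
    change IsLast _ _ ((nearestAll ev X _ Op.rel).val a e)
    rw [val_nearestAll]
    refine (nearest_finRange_reverse_isLast ev false _ e).congr fun g => ?_
    simp only [Bool.and_eq_true, decide_eq_true_eq, le_iff_lt_or_eq, true_and, @eq_comm _ e g, and_assoc]

/-! #### Step counts -/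

theorem steps_lastBefore_le (ev : Fin n → Event k) (o : Op) (e : Fin n) :
    (lastBefore ev o e).steps ≤ n + 1 :=
  (Timed.steps_foreach_le (c := 0) fun _ _ => le_rfl).trans (by simp)

theorem steps_lastBeforeAll_le (ev : Fin n → Event k) (o o' : Op) :
    (lastBeforeAll ev o o').steps ≤ n + 1 + (n * (n + 2) + 1) := by
  refine Nat.add_le_add_left ((Timed.steps_foreach_le (c := n + 1) fun f e => ?_).trans
    (by simp)) _
  have := steps_lastBefore_le ev o e
  simp only [Timed.steps_ite, Timed.steps_bind, Timed.steps_pure]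
  split_ifs <;> omega

theorem steps_nearest_le (ev : Fin n → Event k) (strict : Bool) {order : List (Fin n)}
    (horder : order.length = n) (sel : Fin n → Bool) :
    (nearest ev strict order sel).steps ≤ k + 1 + (n + 1 + (n + 1)) := by
  refine Nat.add_le_add_left (Nat.add_le_add_left (?_ : _ + 0 ≤ _) _) _
  exact (Timed.steps_foreach_le (c := 0) fun f e => le_rfl).trans (by simp [horder])

theorem steps_nearestAll_le (ev : Fin n → Event k) (X : Fin n → Bool) {order : List (Fin n)}
    (horder : order.length = n) (o : Op) :
    (nearestAll ev X order o).steps ≤ n + 1 + (n + 1 + (n * (k + 1 + (n + 1 + (n + 1)) + 1) + 1)) := by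
  refine Nat.add_le_add_left (Nat.add_le_add_left ?_ _) _
  refine (Timed.steps_foreach_le (c := k + 1 + (n + 1 + (n + 1))) fun f e => ?_).trans (by simp)
  exact steps_nearest_le ev false horder _

theorem steps_buildMaps_le (ev : Fin n → Event k) (X : Fin n → Bool) :
    (buildMaps ev X).steps ≤ 10 * (k + 4) * (n + 1) ^ 2 := by
  have h₁ := steps_lastBeforeAll_le ev Op.write Op.read
  have h₂ := steps_lastBeforeAll_le ev Op.acq Op.rel
  have h₃ : ∀ {σ : Type} (s : σ) (f : σ → Fin n → σ),
      (Timed.foreach (List.finRange n) s fun s a => pure (f s a)).steps ≤ n + 1 := fun s f =>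
    (Timed.steps_foreach_le (c := 0) fun _ _ => le_rfl).trans (by simp)
  have h₄ := steps_nearest_le ev true (order := (List.finRange n).reverse) (by simp) X
  have h₅ := steps_nearest_le ev true (order := List.finRange n) (by simp) X
  have h₆ := steps_nearestAll_le ev X (order := (List.finRange n).reverse) (by simp) Op.write
  have h₇ := steps_nearestAll_le ev X (order := List.finRange n) (by simp) Op.write
  have h₈ := steps_nearestAll_le ev X (order := (List.finRange n).reverse) (by simp) Op.rel
  -- The nesting follows the sequence of binds in `buildMaps`; the `le_rfl` stand for the
  -- allocations, the extra charge for the flow table and the final `pure`.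
  refine (add_le_add h₁ (add_le_add h₂ (add_le_add le_rfl (add_le_add (h₃ _ _) (add_le_add le_rfl
    (add_le_add le_rfl (add_le_add (h₃ _ _) (add_le_add h₄ (add_le_add h₅ (add_le_add h₆
    (add_le_add h₇ (add_le_add h₈ le_rfl)))))))))))).trans ?_
  simp only [Timed.steps_alloc, Timed.steps_tick, Timed.steps_pure]
  nlinarith [Nat.zero_le (k * n), Nat.zero_le (n * n), Nat.zero_le (k * n * n)]

end Maps

/-! ### The pairs that become ordered by an insertion -/

/-- The computation adds to the list `acc` the elements with the property `p`, each once, at a cost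
of `B` for each of them and `c` times that besides. -/
def Timed.Collects {β : Type} (m : Timed (List β)) (acc : List β) (p : β → Prop) (B c : ℕ) : Prop :=
  ∃ l, m.val = l ++ acc ∧ l.Nodup ∧ (∀ x, x ∈ l ↔ p x) ∧ m.steps ≤ B * (l.length + c)

namespace Timed.Collects

variable {α β : Type} {m : Timed (List β)} {acc : List β} {p q : β → Prop} {B c : ℕ}

theorem congr (h : m.Collects acc p B c) (hpq : ∀ x, p x ↔ q x) : m.Collects acc q B c := by
  rwa [show q = p from funext fun x => propext (hpq x).symm]

theorem of_isEmpty (hm : m.val = acc) (hp : ∀ x, ¬ p x) (hs : m.steps ≤ B * c) :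
    m.Collects acc p B c :=
  ⟨[], hm, List.nodup_nil, fun x => by simp [hp x], by simpa using hs⟩

theorem add_steps (h : m.Collects acc p B c) {m' : Timed (List β)} (hval : m'.val = m.val)
    (hs : m'.steps ≤ B + m.steps) : m'.Collects acc p B (c + 1) := by
  obtain ⟨l, h₁, h₂, h₃, h₄⟩ := h
  refine ⟨l, hval.trans h₁, h₂, h₃, ?_⟩
  rw [← add_assoc, mul_add, mul_one]
  omega

/-- An element determines the iteration that collects it (`hdisj`), so no repetition arises across
iterations. The overhead per iteration grows from `c` to `c + 1` for the loop itself, and the last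
`1` pays for the end of the loop. -/
theorem foreach {l : List α} {body : List β → α → Timed (List β)} {p : α → β → Prop}
    (hl : l.Nodup) (hB : 1 ≤ B) (hdisj : ∀ a b x, p a x → p b x → a = b)
    (h : ∀ a ∈ l, ∀ acc, (body acc a).Collects acc (p a) B c) (acc : List β) :
    (Timed.foreach l acc body).Collects acc (fun x => ∃ a ∈ l, p a x) B ((c + 1) * l.length + 1) := by
  induction l generalizing acc with
  | nil => exact of_isEmpty rfl (by simp) (by simpa using hB)
  | cons a l ih =>
    obtain ⟨r, h₁, h₂, h₃, h₄⟩ := h a (by simp) acc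
    rw [List.nodup_cons] at hl
    obtain ⟨r', h₁', h₂', h₃', h₄'⟩ :=
      ih hl.2 (fun b hb => h b (by simp [hb])) (body acc a).val
    refine ⟨r' ++ r, ?_, ?_, ?_, ?_⟩
    · rw [val_foreach_cons, h₁', h₁, List.append_assoc]
    · refine h₂'.append h₂ fun x hx hx' => ?_
      obtain ⟨b, hb, hbx⟩ := (h₃' x).1 hx
      exact hl.1 (hdisj a b x ((h₃ x).1 hx') hbx ▸ hb)
    · intro x
      simp [h₃, h₃', or_comm]
    · rw [steps_foreach_cons, List.length_append, List.length_cons]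
      nlinarith

end Timed.Collects

section Walks

variable {k n : ℕ} {ev : Fin n → Event k} {X : Finset (Fin n)} {M : EventMaps k n} {D : DS k n}

theorem reached_mono {hi : Option (Fin n)} {g y : Fin n} (h : reached hi g = true) (hgy : g ≤ y) :
    reached hi y = true := by
  cases hi with
  | none => exact h
  | some e => simpa [reached] using (of_decide_eq_true h).trans hgy

/-- The events that have not reached the bound form an initial segment of the walk, so stopping at
the first failure misses nothing. -/
theorem walkUp_spec (hM : M.Correct ev fun e => decide (e ∈ X)) (f : Fin n) (hi : Option (Fin n))
    {fuel : ℕ} {g : Fin n} (hg : g ∈ X) (hfuel : n ≤ fuel + g) (acc : List (Fin n × Fin n)) :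
    (walkUp M f hi fuel g acc).Collects acc (fun p => p.1 = f ∧ p.2 ∈ X ∧
      (ev p.2).proc = (ev g).proc ∧ g ≤ p.2 ∧ ¬ reached hi p.2 = true) 1 1 := by
  induction fuel generalizing g acc with
  -- Each step moves `g` to a larger position, which preserves `n ≤ fuel + g`; with no fuel left
  -- this would put `g` outside the trace.
  | zero => exact absurd g.2 (by omega)
  | succ fuel ih =>
    by_cases hr : reached hi g = true
    · exact Timed.Collects.of_isEmpty (by simp [walkUp, hr])
        (fun x hx => hx.2.2.2.2 (reached_mono hr hx.2.2.2.1)) (by simp [walkUp, hr])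
    · have hnext := hM.next g
      cases h : M.next g with
      | none =>
        have hlast := hnext.of_eq_none h
        refine ⟨[(f, g)], by simp [walkUp, hr, h], by simp, ?_, by simp [walkUp, hr, h]⟩
        rintro ⟨x, y⟩
        simp only [List.mem_singleton, Prod.mk.injEq]
        constructor
        · rintro ⟨rfl, rfl⟩
          exact ⟨rfl, hg, rfl, le_rfl, hr⟩
        · rintro ⟨rfl, hyX, hyp, hgy, -⟩
          refine ⟨rfl, hgy.eq_or_lt.elim Eq.symm fun hlt => absurd ⟨?_, hyp, hlt⟩ (hlast y)⟩
          simpa using hyX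
      | some g' =>
        obtain ⟨⟨hg'X, hg'p, hgg'⟩, hlast⟩ := hnext.of_eq_some h
        have hg'X : g' ∈ X := by simpa using hg'X
        obtain ⟨l, h₁, h₂, h₃, h₄⟩ := ih hg'X
          (by have := Fin.lt_def.1 hgg'; omega) ((f, g) :: acc)
        refine ⟨l ++ [(f, g)], by simp [walkUp, hr, h, h₁], ?_, ?_, ?_⟩
        · refine h₂.append (by simp) fun p hp hp' => ?_
          obtain rfl := List.mem_singleton.1 hp'
          exact hgg'.not_ge ((h₃ _).1 hp).2.2.2.1
        · rintro ⟨x, y⟩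
          simp only [List.mem_append, h₃, List.mem_singleton, Prod.mk.injEq, hg'p]
          constructor
          · rintro (⟨h₁, h₂, h₃, h₄, h₅⟩ | ⟨rfl, rfl⟩)
            exacts [⟨h₁, h₂, h₃, hgg'.le.trans h₄, h₅⟩, ⟨rfl, hg, rfl, le_rfl, hr⟩]
          · rintro ⟨rfl, hyX, hyp, hgy, hyr⟩
            rcases hgy.eq_or_lt with rfl | hlt
            · exact Or.inr ⟨rfl, rfl⟩
            · refine Or.inl ⟨rfl, hyX, hyp, ?_, hyr⟩
              rcases hlast y ⟨by simpa using hyX, hyp, hlt⟩ with rfl | h'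
              exacts [le_rfl, le_of_lt h']
        · simp only [walkUp, Timed.steps_bind, Timed.steps_tick, hr, h, List.length_append,
            List.length_singleton]
          simp only [Bool.false_eq_true, if_false]
          omega

/-- If `f ≤ g` already holds in `D`, then every earlier `f'` of the process is below every later
`g'`, so the walk may stop there. Otherwise the unordered partners of `f` run from `g` up to the
successor of `f` in process `j`. -/
theorem walkDown_spec (hM : M.Correct ev fun e => decide (e ∈ X)) (hD : D.WF X)
    (hp : ∀ e, D.proc e = (ev e).proc) {g : Fin n} (hg : g ∈ X) {fuel : ℕ} {f : Fin n}
    (hf : f ∈ X) (hfuel : (f : ℕ) < fuel) (acc : List (Fin n × Fin n)) :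
    (walkDown M D (ev g).proc g fuel f acc).Collects acc (fun p => p.1 ∈ X ∧
      (ev p.1).proc = (ev f).proc ∧ p.1 ≤ f ∧ p.2 ∈ X ∧ (ev p.2).proc = (ev g).proc ∧ g ≤ p.2 ∧
      ¬ D.le p.1 p.2) (Nat.clog 2 n + 5) 1 := by
  induction fuel generalizing f acc with
  | zero => omega
  | succ fuel ih =>
    have hsucc := D.steps_succ_le f (ev g).proc
    have hreach : ∀ y, (ev y).proc = (ev g).proc →
        (reached (D.succ f (ev g).proc).val y = true ↔ D.le f y) := by
      intro y hy
      rw [DS.le_iff_succ, hp, hy]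
      cases (D.succ f (ev g).proc).val <;> simp [reached]
    by_cases hr : reached (D.succ f (ev g).proc).val g = true
    · refine Timed.Collects.of_isEmpty (by simp [walkDown, hr]) (fun p h => ?_) ?_
      · obtain ⟨h₁, h₂, h₃, h₄, h₅, h₆, h₇⟩ := h
        exact h₇ (DS.le_mono hD.tree (by rw [hp, hp, h₂]) h₃ (by rw [hp, hp, h₅]) h₆
          ((hreach g rfl).1 hr))
      · simp only [walkDown, Timed.steps_bind, Timed.steps_tick, hr, if_true, Timed.steps_pure]
        omega
    · obtain ⟨l, h₁, h₂, h₃, h₄⟩ :=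
        walkUp_spec hM f (D.succ f (ev g).proc).val hg (Nat.le_add_right n g) acc
      -- Every `f` that passes the test yields at least the pair `(f, g)`, which pays for its
      -- successor query. The fixed cost `Nat.clog 2 n + 4` together with one unit per pair is at
      -- most `Nat.clog 2 n + 5` per pair; only the final failed test is overhead.
      have hl : 1 ≤ l.length :=
        List.length_pos_of_mem ((h₃ (f, g)).2 ⟨rfl, hg, rfl, le_rfl, hr⟩)
      have hprev := hM.prev f
      have hmem : ∀ x y, (x, y) ∈ l ↔ x = f ∧ y ∈ X ∧ (ev y).proc = (ev g).proc ∧ g ≤ y ∧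
          ¬ D.le f y := by
        intro x y
        rw [h₃]
        refine and_congr_right fun _ => and_congr_right fun _ => and_congr_right fun hy => ?_
        rw [hreach y hy]
      cases h : M.prev f with
      | none =>
        have hfirst := hprev.of_eq_none h
        refine ⟨l, by simp [walkDown, hr, h, h₁], h₂, ?_, ?_⟩
        · rintro ⟨x, y⟩
          rw [hmem]
          constructor
          · rintro ⟨rfl, h₁, h₂, h₃, h₄⟩
            exact ⟨hf, rfl, le_rfl, h₁, h₂, h₃, h₄⟩
          · rintro ⟨h₁, h₂, h₃, h₄, h₅, h₆, h₇⟩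
            have hxf : x = f := h₃.eq_or_lt.elim id fun hlt =>
              absurd ⟨by simpa using h₁, h₂, hlt⟩ (hfirst x)
            exact ⟨hxf, h₄, h₅, h₆, hxf ▸ h₇⟩
        · simp only [walkDown, Timed.steps_bind, Timed.steps_tick, hr, h, Timed.steps_pure,
            Bool.false_eq_true, if_false]
          nlinarith
      | some f' =>
        obtain ⟨⟨hf'X, hf'p, hff'⟩, hfirst⟩ := hprev.of_eq_some h
        obtain ⟨l', h₁', h₂', h₃', h₄'⟩ := ih (f := f') (by simpa using hf'X)
          (by have := Fin.lt_def.1 hff'; omega)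
          (walkUp M f (D.succ f (ev g).proc).val n g acc).val
        refine ⟨l' ++ l, ?_, ?_, ?_, ?_⟩
        · rw [List.append_assoc, ← h₁, ← h₁']
          simp [walkDown, hr, h]
        · refine h₂'.append h₂ fun p hp' hp'' => ?_
          have h₅ := ((h₃' p).1 hp').2.2.1
          rw [((h₃ p).1 hp'').1] at h₅
          exact hff'.not_ge h₅
        · rintro ⟨x, y⟩
          rw [List.mem_append, hmem, h₃']
          constructor
          · rintro (⟨h₁, h₂, h₃, h₄⟩ | ⟨rfl, h₁, h₂, h₃, h₄⟩)
            exacts [⟨h₁, h₂.trans hf'p, h₃.trans hff'.le, h₄⟩, ⟨hf, rfl, le_rfl, h₁, h₂, h₃, h₄⟩]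
          · rintro ⟨hx, hxf, hle, hy⟩
            rcases hle.eq_or_lt with rfl | hlt
            · exact Or.inr ⟨rfl, hy⟩
            · refine Or.inl ⟨hx, hxf.trans hf'p.symm, ?_, hy⟩
              rcases hfirst x ⟨by simpa using hx, hxf, hlt⟩ with rfl | h'
              exacts [le_rfl, le_of_lt h']
        · simp only [walkDown, Timed.steps_bind, Timed.steps_tick, hr, h,
            Bool.false_eq_true, if_false, List.length_append]
          nlinarith

/-- The inner loop of `newPairs`. -/
def newPairsRow (M : EventMaps k n) (D : DS k n) (b : Fin n) (i : Fin k) (f : Fin n)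
    (acc : List (Fin n × Fin n)) : Timed (List (Fin n × Fin n)) :=
  Timed.foreach (List.finRange k) acc fun acc' j => do
    match ← D.succ b j with
    | none => pure acc'
    | some g => if i = j then pure acc' else walkDown M D j g n f acc'

theorem newPairsRow_spec (hM : M.Correct ev fun e => decide (e ∈ X)) (hD : D.WF X)
    (hp : ∀ e, D.proc e = (ev e).proc) {b : Fin n} (hb : b ∈ X) {f : Fin n}
    (hf : f ∈ X) (acc : List (Fin n × Fin n)) :
    (newPairsRow M D b (ev f).proc f acc).Collects acc (fun p => p.1 ∈ X ∧
      (ev p.1).proc = (ev f).proc ∧ p.1 ≤ f ∧ p.2 ∈ X ∧ (ev p.1).proc ≠ (ev p.2).proc ∧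
      D.le b p.2 ∧ ¬ D.le p.1 p.2) (Nat.clog 2 n + 5) (3 * k + 1) := by
  have key := Timed.Collects.foreach (l := List.finRange k) (B := Nat.clog 2 n + 5) (c := 2)
    (body := fun acc' j => do
      match ← D.succ b j with
      | none => pure acc'
      | some g => if (ev f).proc = j then pure acc' else walkDown M D j g n f acc')
    (p := fun j p => p.1 ∈ X ∧ (ev p.1).proc = (ev f).proc ∧ p.1 ≤ f ∧ p.2 ∈ X ∧
      (ev p.2).proc = j ∧ (ev p.1).proc ≠ (ev p.2).proc ∧ D.le b p.2 ∧ ¬ D.le p.1 p.2)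
    (List.nodup_finRange k) (by omega) (by grind) (fun j _ acc => ?_) acc
  · rw [List.length_finRange] at key
    refine Timed.Collects.congr key fun p => ?_
    simp
  · have hsucc := D.steps_succ_le b j
    cases h : (D.succ b j).val with
    | none =>
      refine Timed.Collects.of_isEmpty (by simp [h]) (fun p hx => ?_) ?_
      · obtain ⟨g, hg, -⟩ := DS.le_iff_succ.1 hx.2.2.2.2.2.2.1
        rw [hp, hx.2.2.2.2.1, h] at hg
        cases hg
      · simp only [Timed.steps_bind, h, Timed.steps_pure]
        omega
    | some g =>
      obtain ⟨hgj, hbg, hgX⟩ := DS.succ_eq_some hD h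
      rw [hp] at hgj
      by_cases hij : (ev f).proc = j
      · refine Timed.Collects.of_isEmpty (by simp [h, hij]) (fun p hx => ?_) ?_
        · exact hx.2.2.2.2.2.1 (by rw [hx.2.1, hij, hx.2.2.2.2.1])
        · simp only [Timed.steps_bind, h, hij, if_true, Timed.steps_pure]
          omega
      · subst hgj
        refine ((walkDown_spec hM hD hp (hgX hb) hf f.2 acc).congr fun p => ?_).add_steps
          (by simp [h, hij]) ?_
        · have : (ev p.2).proc = (ev g).proc → (D.le b p.2 ↔ g ≤ p.2) := by
            intro hy
            rw [DS.le_iff_succ, hp, hy, h]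
            simp
          grind
        · simp only [Timed.steps_bind, h, hij, if_false]
          omega

/-- The first component of a pair fixes the process `i` and the second fixes `j`, so the `k * k`
walks are disjoint and no pair is listed twice. The overhead comes from the calls that find nothing
and from the predecessor and successor queries. -/
theorem newPairs_spec (hM : M.Correct ev fun e => decide (e ∈ X)) (hD : D.WF X)
    (hp : ∀ e, D.proc e = (ev e).proc) {a b : Fin n} (ha : a ∈ X) (hb : b ∈ X) :
    (newPairs M D a b).Collects [] (fun p => p.1 ∈ X ∧ p.2 ∈ X ∧
      (ev p.1).proc ≠ (ev p.2).proc ∧ D.le p.1 a ∧ D.le b p.2 ∧ ¬ D.le p.1 p.2)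
      (Nat.clog 2 n + 5) ((3 * k + 3) * k + 1) := by
  have key := Timed.Collects.foreach (l := List.finRange k) (B := Nat.clog 2 n + 5) (c := 3 * k + 2)
    (body := fun acc i => do
      match ← D.pred a i with
      | none => pure acc
      | some f => newPairsRow M D b i f acc)
    (p := fun i p => p.1 ∈ X ∧ (ev p.1).proc = i ∧ p.2 ∈ X ∧
      (ev p.1).proc ≠ (ev p.2).proc ∧ D.le p.1 a ∧ D.le b p.2 ∧ ¬ D.le p.1 p.2)
    (List.nodup_finRange k) (by omega) (by grind) (fun i _ acc => ?_) []
  · rw [List.length_finRange] at key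
    refine Timed.Collects.congr key fun p => ?_
    simp
  · have hpred := D.steps_pred_le a i
    cases h : (D.pred a i).val with
    | none =>
      refine Timed.Collects.of_isEmpty (by simp [h]) (fun p hx => ?_) ?_
      · obtain ⟨g, hg, -⟩ := (DS.le_iff_pred hD).1 hx.2.2.2.2.1
        rw [hp, hx.2.1, h] at hg
        cases hg
      · simp only [Timed.steps_bind, h, Timed.steps_pure]
        nlinarith
    | some f =>
      obtain ⟨hfi, hfa, hfX⟩ := DS.pred_eq_some hD h
      rw [hp] at hfi
      subst hfi
      refine ((newPairsRow_spec hM hD hp hb (hfX ha) acc).congr fun p => ?_).add_steps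
        (by simp [h]) ?_
      · have : (ev p.1).proc = (ev f).proc → (D.le p.1 a ↔ p.1 ≤ f) := by
          intro hy
          rw [DS.le_iff_pred hD, hp, hy, h]
          simp
        grind
      · simp only [Timed.steps_bind, h]
        omega

end Walks

/-! ### Further principles for loops -/

/-- Besides the invariant `p`, it tracks achievements: `q a` is established by the iteration of `a`
and survives all other iterations. -/
theorem Timed.foreach_induction_mem {α σ : Type} {l : List α} {s : σ} {body : σ → α → Timed σ}
    (p : σ → Prop) (q : α → σ → Prop) (h₀ : p s)
    (h : ∀ s, p s → ∀ a ∈ l, p (body s a).val ∧ q a (body s a).val ∧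
      ∀ b, q b s → q b (body s a).val) :
    p (foreach l s body).val ∧ (∀ a ∈ l, q a (foreach l s body).val) ∧
      ∀ b, q b s → q b (foreach l s body).val := by
  induction l generalizing s with
  | nil => exact ⟨h₀, by simp, fun b => id⟩
  | cons a l ih =>
    obtain ⟨h₁, h₂, h₃⟩ := h s h₀ a (by simp)
    obtain ⟨h₄, h₅, h₆⟩ := ih h₁ fun s hs b hb => h s hs b (by simp [hb])
    refine ⟨h₄, fun b hb => ?_, fun b hb => h₆ b (h₃ b hb)⟩
    rcases List.mem_cons.1 hb with rfl | hb
    exacts [h₆ _ h₂, h₅ b hb]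

theorem Timed.foreach_measure_le {α σ : Type} {l : List α} {s : σ} {body : σ → α → Timed σ}
    (μ : σ → ℕ) {c : ℕ} (h : ∀ s a, μ (body s a).val ≤ μ s + c) :
    μ (foreach l s body).val ≤ μ s + l.length * c := by
  induction l generalizing s with
  | nil => simp
  | cons a l ih =>
    have h₁ := h s a
    have h₂ := ih (s := (body s a).val)
    simp only [val_foreach_cons, List.length_cons, add_mul, one_mul]
    omega

theorem Timed.mem_foreach {α β : Type} {l : List α} {acc : List β}
    {body : List β → α → Timed (List β)} {p : α → β → Prop}
    (h : ∀ acc, ∀ a, ∀ x, x ∈ (body acc a).val ↔ x ∈ acc ∨ p a x) (x : β) :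
    x ∈ (foreach l acc body).val ↔ x ∈ acc ∨ ∃ a ∈ l, p a x := by
  induction l generalizing acc with
  | nil => simp
  | cons a l ih => simp [ih, h, or_assoc]

/-! ### The closure rules -/

section Rules

variable {k n : ℕ} {ev : Fin n → Event k} {M : EventMaps k n}

/-- The rules impose the ordering `p` because of `e₁ < e₂`. -/
def Imposes (ev : Fin n → Event k) (M : EventMaps k n) (e₁ e₂ : Fin n) (p : Fin n × Fin n) : Prop :=
  ((ev e₁).op = Op.write ∧ ∃ w' q r, M.afterW e₁ e₂ = some w' ∧ M.flow e₁ q = some r ∧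
    p = (r, w')) ∨
  ((ev e₂).op = Op.read ∧ ∃ w' w, M.beforeW e₂ e₁ = some w' ∧ M.obs e₂ = some w ∧ w' ≠ w ∧
    p = (w', w)) ∨
  ((ev e₁).op = Op.acq ∧ ∃ l₁ l₂ a₂, M.relOf e₁ = some l₁ ∧ M.afterRel e₁ e₂ = some l₂ ∧
    M.acqOf l₂ = some a₂ ∧ l₁ ≠ l₂ ∧ p = (l₁, a₂))

/-- The orderings pushed by the rule for writes. -/
def pushReads (M : EventMaps k n) (e₁ e₂ : Fin n) (Q : List (Fin n × Fin n)) :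
    Timed (List (Fin n × Fin n)) :=
  match M.afterW e₁ e₂ with
  | none => pure Q
  | some w' => Timed.foreach (List.finRange k) Q fun Q' p =>
      pure <| match M.flow e₁ p with
        | none => Q'
        | some r => (r, w') :: Q'

theorem mem_pushReads {e₁ e₂ : Fin n} {Q : List (Fin n × Fin n)} {p : Fin n × Fin n} :
    p ∈ (pushReads M e₁ e₂ Q).val ↔ p ∈ Q ∨ ∃ w' q r, M.afterW e₁ e₂ = some w' ∧
      M.flow e₁ q = some r ∧ p = (r, w') := by
  unfold pushReads
  cases M.afterW e₁ e₂ with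
  | none => simp
  | some w' =>
    simp only
    rw [Timed.mem_foreach (p := fun q x => ∃ r, M.flow e₁ q = some r ∧ x = (r, w'))]
    · simp
    · intro acc q x
      cases M.flow e₁ q <;> simp [or_comm]

theorem length_pushReads_le (e₁ e₂ : Fin n) (Q : List (Fin n × Fin n)) :
    (pushReads M e₁ e₂ Q).val.length ≤ Q.length + k := by
  unfold pushReads
  cases M.afterW e₁ e₂ with
  | none => simp
  | some w' =>
    refine (Timed.foreach_measure_le List.length (c := 1) fun acc q => ?_).trans (by simp)
    cases M.flow e₁ q <;> simp

theorem steps_pushReads_le (e₁ e₂ : Fin n) (Q : List (Fin n × Fin n)) :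
    (pushReads M e₁ e₂ Q).steps ≤ k + 1 := by
  unfold pushReads
  cases M.afterW e₁ e₂ with
  | none => simp
  | some w' => exact (Timed.steps_foreach_le (c := 0) fun _ _ => le_rfl).trans (by simp)

/-- Isolates the only rule with a loop, so that its contents, length and cost can be treated
separately. -/
theorem obsClosure_eq (ev : Fin n → Event k) (M : EventMaps k n) (Q : List (Fin n × Fin n))
    (e₁ e₂ : Fin n) : obsClosure ev M Q e₁ e₂ =
      tick 1 >>= fun _ =>
      (if (ev e₁).op = Op.write then pushReads M e₁ e₂ Q else pure Q) >>= fun Q₁ =>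
      if (ev e₂).op = Op.read then
        match M.beforeW e₂ e₁, M.obs e₂ with
        | some w', some w => pure (if w' = w then Q₁ else (w', w) :: Q₁)
        | _, _ => pure Q₁
      else pure Q₁ := by
  unfold obsClosure pushReads
  split_ifs <;> cases M.afterW e₁ e₂ <;> rfl

theorem mem_obsClosure {Q : List (Fin n × Fin n)} {e₁ e₂ : Fin n} {p : Fin n × Fin n} :
    p ∈ (obsClosure ev M Q e₁ e₂).val ↔ p ∈ Q ∨
      ((ev e₁).op = Op.write ∧ ∃ w' q r, M.afterW e₁ e₂ = some w' ∧ M.flow e₁ q = some r ∧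
        p = (r, w')) ∨
      ((ev e₂).op = Op.read ∧ ∃ w' w, M.beforeW e₂ e₁ = some w' ∧ M.obs e₂ = some w ∧ w' ≠ w ∧
        p = (w', w)) := by
  rw [obsClosure_eq, ← or_assoc]
  simp only [Timed.val_bind, Timed.val_ite, Timed.val_pure]
  have h : p ∈ (if (ev e₁).op = Op.write then (pushReads M e₁ e₂ Q).val else Q) ↔
      p ∈ Q ∨ ((ev e₁).op = Op.write ∧ ∃ w' q r, M.afterW e₁ e₂ = some w' ∧
        M.flow e₁ q = some r ∧ p = (r, w')) := by
    split_ifs with hw <;> simp [mem_pushReads, hw]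
  rw [← h]
  by_cases hr : (ev e₂).op = Op.read
  · cases h₁ : M.beforeW e₂ e₁ <;> cases h₂ : M.obs e₂ <;> simp [hr]
    rename_i w' w
    by_cases h₃ : w' = w <;> simp [h₃, or_comm]
  · simp [hr]

theorem length_obsClosure_le (Q : List (Fin n × Fin n)) (e₁ e₂ : Fin n) :
    (obsClosure ev M Q e₁ e₂).val.length ≤ Q.length + (k + 1) := by
  have h := length_pushReads_le (M := M) e₁ e₂ Q
  rw [obsClosure_eq]
  by_cases hw : (ev e₁).op = Op.write <;> by_cases hr : (ev e₂).op = Op.read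
  all_goals cases h₁ : M.beforeW e₂ e₁ <;> cases h₂ : M.obs e₂ <;> simp [hw, hr]
  all_goals first | omega | (split_ifs <;> (try simp only [List.length_cons]) <;> omega)

theorem steps_obsClosure_le (Q : List (Fin n × Fin n)) (e₁ e₂ : Fin n) :
    (obsClosure ev M Q e₁ e₂).steps ≤ k + 2 := by
  have h := steps_pushReads_le (M := M) e₁ e₂ Q
  rw [obsClosure_eq]
  by_cases hw : (ev e₁).op = Op.write <;> by_cases hr : (ev e₂).op = Op.read
  all_goals cases h₁ : M.beforeW e₂ e₁ <;> cases h₂ : M.obs e₂ <;> simp [hw, hr]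
  all_goals omega

theorem mem_lockClosure {Q : List (Fin n × Fin n)} {e₁ e₂ : Fin n} {p : Fin n × Fin n} :
    p ∈ (lockClosure ev M Q e₁ e₂).val ↔ p ∈ Q ∨ ((ev e₁).op = Op.acq ∧ ∃ l₁ l₂ a₂,
      M.relOf e₁ = some l₁ ∧ M.afterRel e₁ e₂ = some l₂ ∧ M.acqOf l₂ = some a₂ ∧ l₁ ≠ l₂ ∧
        p = (l₁, a₂)) := by
  unfold lockClosure
  by_cases hr : (ev e₁).op = Op.acq
  · cases h₁ : M.relOf e₁ <;> cases h₂ : M.afterRel e₁ e₂ <;> simp [hr]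
    rename_i l₁ l₂
    cases h₃ : M.acqOf l₂ <;> simp
    split_ifs with h₄ <;> simp [h₄, or_comm]
  · simp [hr]

theorem length_lockClosure_le (Q : List (Fin n × Fin n)) (e₁ e₂ : Fin n) :
    (lockClosure ev M Q e₁ e₂).val.length ≤ Q.length + 1 := by
  unfold lockClosure
  by_cases hr : (ev e₁).op = Op.acq
  · cases h₁ : M.relOf e₁ <;> cases h₂ : M.afterRel e₁ e₂ <;> simp [hr]
    rename_i l₁ l₂
    cases h₃ : M.acqOf l₂ <;> simp
    split_ifs with h₄ <;> simp
  · simp [hr]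

theorem steps_lockClosure_le (Q : List (Fin n × Fin n)) (e₁ e₂ : Fin n) :
    (lockClosure ev M Q e₁ e₂).steps ≤ 1 := by
  unfold lockClosure
  by_cases hr : (ev e₁).op = Op.acq
  · cases h₁ : M.relOf e₁ <;> cases h₂ : M.afterRel e₁ e₂ <;> simp [hr]
    rename_i l₁ l₂
    cases h₃ : M.acqOf l₂ <;> simp
  · simp [hr]

theorem mem_applyRules {pairs Q : List (Fin n × Fin n)} {p : Fin n × Fin n} :
    p ∈ (applyRules ev M pairs Q).val ↔ p ∈ Q ∨ ∃ e ∈ pairs, Imposes ev M e.1 e.2 p := by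
  unfold applyRules
  refine Timed.mem_foreach (p := fun (e : Fin n × Fin n) p => Imposes ev M e.1 e.2 p)
    (fun acc e x => ?_) p
  simp only [Timed.val_bind, mem_lockClosure, mem_obsClosure, Imposes, or_assoc]

theorem length_applyRules_le (pairs Q : List (Fin n × Fin n)) :
    (applyRules ev M pairs Q).val.length ≤ Q.length + pairs.length * (k + 2) :=
  Timed.foreach_measure_le List.length fun acc e => by
    have h₁ := length_obsClosure_le (ev := ev) (M := M) acc e.1 e.2
    have h₂ := length_lockClosure_le (ev := ev) (M := M) (obsClosure ev M acc e.1 e.2).val e.1 e.2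
    simp only [Timed.val_bind]
    omega

theorem steps_applyRules_le (pairs Q : List (Fin n × Fin n)) :
    (applyRules ev M pairs Q).steps ≤ pairs.length * (k + 4) + 1 :=
  Timed.steps_foreach_le (c := k + 3) fun acc e => by
    have h₁ := steps_obsClosure_le (ev := ev) (M := M) acc e.1 e.2
    have h₂ := steps_lockClosure_le (ev := ev) (M := M) (obsClosure ev M acc e.1 e.2).val e.1 e.2
    simp only [Timed.steps_bind]
    omega

end Rules

/-! ### The rules compute the closure -/

namespace Trace

variable {k n : ℕ} {t : Trace k n} {X : Finset (Fin n)} {M : EventMaps k n}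

theorem obs_eq_some_iff (hM : M.Correct t.ev fun e => decide (e ∈ X)) {r w : Fin n}
    (hr : (t.ev r).op = Op.read) : M.obs r = some w ↔ t.Observes r w := by
  constructor
  · intro h
    obtain ⟨⟨h₁, h₂, h₃⟩, h₄⟩ := (hM.obs r hr).of_eq_some h
    exact ⟨hr, h₂, h₃, h₁, fun w' h₅ h₆ h₇ => (h₄ w' ⟨h₇, h₅, h₆⟩).elim le_of_eq le_of_lt⟩
  · rintro ⟨-, h₂, h₃, h₁, h₄⟩
    obtain ⟨w', h₅, ⟨h₆, h₇, h₈⟩, h₉⟩ := (hM.obs r hr).exists_of ⟨h₁, h₂, h₃⟩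
    rw [h₅, le_antisymm (h₄ w' h₇ h₈ h₆) (h₉.elim le_of_eq le_of_lt)]

theorem Matching.acqOf_eq (hM : M.Correct t.ev fun e => decide (e ∈ X)) {a l : Fin n}
    (h : t.Matching a l) : M.acqOf l = some a := by
  obtain ⟨h₁, h₂, h₃, h₄, h₅⟩ := h
  obtain ⟨a', h₆, ⟨h₇, h₈, h₉⟩, h₁₀ | h₁₀⟩ := (hM.acqOf l h₂).exists_of ⟨h₄, h₁, h₃⟩
  · rw [h₆, h₁₀]
  · exact absurd h₉ (h₅ a' h₁₀ h₇ (Or.inl h₈))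

/-- The map stores the last earlier acquire of the lock. The trace provides a matching acquire, and
no acquire of the lock lies between it and `l`, so the two agree. -/
theorem acqOf_eq_some_iff (hM : M.Correct t.ev fun e => decide (e ∈ X)) {a l : Fin n}
    (hl : (t.ev l).op = Op.rel) : M.acqOf l = some a ↔ t.Matching a l := by
  refine ⟨fun h => ?_, Matching.acqOf_eq hM⟩
  obtain ⟨a', h₁, h₂, h₃, -, h₄⟩ := t.rel_closes l hl
  have h₅ : t.Matching a' l := ⟨h₂, hl, h₃, h₁, h₄⟩
  rw [h₅.acqOf_eq hM] at h
  exact Option.some.inj h ▸ h₅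

/-- Of two releases matching `a`, the earlier would lie strictly inside the critical section ended
by the later. -/
theorem Matching.release_unique {a l₁ l₂ : Fin n} (h₁ : t.Matching a l₁) (h₂ : t.Matching a l₂) :
    l₁ = l₂ := by
  have key : ∀ {l l' : Fin n}, t.Matching a l → t.Matching a l' → ¬ l < l' :=
    fun h h' hlt => h'.2.2.2.2 _ h.2.2.2.1 hlt (Or.inr h.2.1) (h.2.2.1.symm.trans h'.2.2.1)
  exact le_antisymm (not_lt.1 (key h₂ h₁)) (not_lt.1 (key h₁ h₂))

/-- The event found by the map is at or after `e₂`, or at or before `e₁`, in the same process. Since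
`Q` refines the process orders, `e₁ < e₂` extends to that event, and a closure condition of `Q`
applies. -/
theorem Imposes.sound {P Q : PartialOrder X} (hX : t.Feasible X) (hP : t.Respects P)
    (hM : M.Correct t.ev fun e => decide (e ∈ X)) (hQ : Refines Q P) (hQc : t.Closed Q)
    {e₁ e₂ : X} (he : Q.lt e₁ e₂) {p : Fin n × Fin n} (hp : Imposes t.ev M e₁ e₂ p) :
    ∃ c d : X, p = (c.1, d.1) ∧ Q.lt c d := by
  have hproc : ∀ a b : X, (t.ev a).proc = (t.ev b).proc → a.1 ≤ b.1 → Q.le a b := by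
    intro a b h hab
    rcases hab.eq_or_lt with hab | hab
    · rw [Subtype.ext hab]
      exact Q.le_refl b
    · exact hQ a b (@le_of_lt _ P.toPreorder _ _ (hP.process_order a b h hab))
  rcases hp with ⟨hw, w', q, r, h₁, h₂, rfl⟩ | ⟨hr, w', w, h₁, h₂, hne, rfl⟩ |
    ⟨ha, l₁, l₂, a₂, h₁, h₂, h₃, hne, rfl⟩
  · obtain ⟨⟨h₃, h₄, h₅, h₆, h₇⟩, -⟩ := (hM.afterW _ _).of_eq_some h₁
    obtain ⟨⟨g₃, g₄, g₅, g₆⟩, -⟩ := (hM.flow _ _).of_eq_some h₂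
    have hw'X : w' ∈ X := by simpa using h₃
    have hrX : r ∈ X := by simpa using g₃
    have hobs := (obs_eq_some_iff hM g₄).1 g₅
    have hlt : Q.lt e₁ ⟨w', hw'X⟩ :=
      @lt_of_lt_of_le _ Q.toPreorder _ _ _ he (hproc e₂ ⟨w', hw'X⟩ h₆.symm h₇)
    refine ⟨⟨r, hrX⟩, ⟨w', hw'X⟩, rfl, hQc.obs_after ⟨r, hrX⟩ e₁ ⟨w', hw'X⟩ hobs h₄
      (h₅.trans hobs.2.2.1) ?_ hlt⟩
    exact (@ne_of_lt _ Q.toPreorder _ _ hlt).symm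
  · obtain ⟨⟨h₃, h₄, h₅, h₆, h₇⟩, -⟩ := (hM.beforeW _ _).of_eq_some h₁
    have hw'X : w' ∈ X := by simpa using h₃
    have hobs := (obs_eq_some_iff hM hr).1 h₂
    have hwX := hX.observed_mem _ e₂.2 w hobs
    have hlt : Q.lt ⟨w', hw'X⟩ e₂ :=
      @lt_of_le_of_lt _ Q.toPreorder _ _ _ (hproc ⟨w', hw'X⟩ e₁ h₆ h₇) he
    exact ⟨⟨w', hw'X⟩, ⟨w, hwX⟩, rfl, hQc.obs_before e₂ ⟨w, hwX⟩ ⟨w', hw'X⟩ hobs h₄ h₅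
      (fun h => hne (congrArg Subtype.val h)) hlt⟩
  · obtain ⟨⟨h₄, h₅, h₆⟩, -⟩ := (hM.relOf _).of_eq_some h₁
    obtain ⟨⟨g₃, g₄, g₅, g₆, g₇⟩, -⟩ := (hM.afterRel _ _).of_eq_some h₂
    have hl₁X : l₁ ∈ X := by simpa using h₄
    have hl₂X : l₂ ∈ X := by simpa using g₃
    have hm₁ := (acqOf_eq_some_iff hM h₅).1 h₆
    have hm₂ := (acqOf_eq_some_iff hM g₄).1 h₃
    have ha₂X := hX.acquire_mem _ hl₂X a₂ hm₂
    have hlt : Q.lt e₁ ⟨l₂, hl₂X⟩ :=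
      @lt_of_lt_of_le _ Q.toPreorder _ _ _ he (hproc e₂ ⟨l₂, hl₂X⟩ g₆.symm g₇)
    exact ⟨⟨l₁, hl₁X⟩, ⟨a₂, ha₂X⟩, rfl, hQc.lock e₁ ⟨l₁, hl₁X⟩ ⟨a₂, ha₂X⟩ ⟨l₂, hl₂X⟩ hm₁ hm₂
      (hm₁.2.2.1.symm.trans g₅.symm) (fun h => hne (congrArg Subtype.val h)) hlt⟩

/-- Needed apart from `Imposes.sound`, which says nothing when no closed order refines `P`; the loop
must still work inside `X` in that case. -/
theorem Imposes.mem (hX : t.Feasible X) (hM : M.Correct t.ev fun e => decide (e ∈ X))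
    {e₁ e₂ : Fin n} (he₂ : e₂ ∈ X) {p : Fin n × Fin n} (hp : Imposes t.ev M e₁ e₂ p) :
    p.1 ∈ X ∧ p.2 ∈ X := by
  rcases hp with ⟨hw, w', q, r, h₁, h₂, rfl⟩ | ⟨hr, w', w, h₁, h₂, hne, rfl⟩ |
    ⟨ha, l₁, l₂, a₂, h₁, h₂, h₃, hne, rfl⟩
  · obtain ⟨⟨h₃, -⟩, -⟩ := (hM.afterW _ _).of_eq_some h₁
    obtain ⟨⟨g₃, -⟩, -⟩ := (hM.flow _ _).of_eq_some h₂
    exact ⟨by simpa using g₃, by simpa using h₃⟩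
  · obtain ⟨⟨h₃, -⟩, -⟩ := (hM.beforeW _ _).of_eq_some h₁
    exact ⟨by simpa using h₃, hX.observed_mem _ he₂ w ((obs_eq_some_iff hM hr).1 h₂)⟩
  · obtain ⟨⟨h₄, -⟩, -⟩ := (hM.relOf _).of_eq_some h₁
    obtain ⟨⟨g₃, g₄, -⟩, -⟩ := (hM.afterRel _ _).of_eq_some h₂
    have hl₂X : l₂ ∈ X := by simpa using g₃
    exact ⟨by simpa using h₄,
      hX.acquire_mem _ hl₂X a₂ ((acqOf_eq_some_iff hM g₄).1 h₃)⟩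

end Trace

/-! ### Stored partial orders and their closedness -/

namespace DS

variable {k n : ℕ} {t : Trace k n} {X : Finset (Fin n)} {M : EventMaps k n} {D : DS k n}

instance (D : DS k n) : DecidableRel D.le := fun a b =>
  inferInstanceAs (Decidable ((D.query a b).val = true))

/-- The data structure is well-formed and stores a partial order. -/
structure IsOrder (D : DS k n) (ev : Fin n → Event k) (X : Finset (Fin n)) : Prop where
  wf : D.WF X
  proc : ∀ e, D.proc e = (ev e).proc
  trans : ∀ a b c, D.le a b → D.le b c → D.le a c
  antisymm : ∀ a b, D.le a b → D.le b a → a = b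

theorem IsOrder.init (ev : Fin n → Event k) (X : Finset (Fin n)) :
    (DS.init fun e => (ev e).proc).val.IsOrder ev X where
  wf := WF_init _
  proc _ := rfl
  trans a b c h₁ h₂ := by
    rw [init_le_iff] at *
    exact ⟨h₁.1.trans h₂.1, h₁.2.trans h₂.2⟩
  antisymm a b h₁ h₂ := by
    rw [init_le_iff] at *
    exact le_antisymm h₁.2 h₂.2

/-- The restriction to different processes disappears: if `x ≤ a`, `b ≤ y` and `y ≤ x` in one
process, then `b ≤ y ≤ x ≤ a`, which is excluded. So the insertion yields the full transitive
extension. -/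
theorem IsOrder.insert_le_iff {ev : Fin n → Event k} (hD : D.IsOrder ev X) {a b : Fin n}
    (ha : a ∈ X) (hb : b ∈ X) (hab : ¬ D.le b a) (x y : Fin n) :
    (D.insert a b).val.le x y ↔ D.le x y ∨ (D.le x a ∧ D.le b y) := by
  rw [(insert_spec hD.wf ha hb).2.2]
  refine ⟨Or.imp_right And.right, ?_⟩
  rintro (h | ⟨hx, hy⟩)
  · exact Or.inl h
  · by_cases hxy : D.proc x = D.proc y
    · rcases le_total x y with h | h
      · exact Or.inl ((le_iff_of_proc_eq hxy).2 h)
      · have := (le_iff_of_proc_eq hxy.symm).2 h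
        exact absurd (hD.trans _ _ _ hy (hD.trans _ _ _ this hx)) hab
    · exact Or.inr ⟨hxy, hx, hy⟩

theorem IsOrder.insert {ev : Fin n → Event k} (hD : D.IsOrder ev X) {a b : Fin n}
    (ha : a ∈ X) (hb : b ∈ X) (hab : ¬ D.le b a) : (D.insert a b).val.IsOrder ev X where
  wf := (insert_spec hD.wf ha hb).1
  proc e := by rw [(insert_spec hD.wf ha hb).2.1, hD.proc]
  trans x y z := by
    simp only [hD.insert_le_iff ha hb hab]
    rintro (h₁ | ⟨h₁, h₂⟩) (h₃ | ⟨h₃, h₄⟩)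
    · exact Or.inl (hD.trans _ _ _ h₁ h₃)
    · exact Or.inr ⟨hD.trans _ _ _ h₁ h₃, h₄⟩
    · exact Or.inr ⟨h₁, hD.trans _ _ _ h₂ h₃⟩
    · exact Or.inr ⟨h₁, h₄⟩
  antisymm x y := by
    simp only [hD.insert_le_iff ha hb hab]
    rintro (h₁ | ⟨h₁, h₂⟩) (h₃ | ⟨h₃, h₄⟩)
    · exact hD.antisymm _ _ h₁ h₃
    · exact absurd (hD.trans _ _ _ h₄ (hD.trans _ _ _ h₁ h₃)) hab
    · exact absurd (hD.trans _ _ _ h₂ (hD.trans _ _ _ h₃ h₁)) hab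
    · exact absurd (hD.trans _ _ _ h₂ h₃) hab

/-- The partial order on `X` stored by the data structure. -/
@[reducible]
def IsOrder.toPartialOrder {ev : Fin n → Event k} (hD : D.IsOrder ev X) : PartialOrder X where
  le a b := D.le a b
  lt a b := D.le a b ∧ ¬ D.le b a
  le_refl a := D.le_refl a
  le_trans a b c := hD.trans a b c
  le_antisymm a b h₁ h₂ := Subtype.ext (hD.antisymm a b h₁ h₂)

theorem IsOrder.le_of_proc_eq {ev : Fin n → Event k} (hD : D.IsOrder ev X) {a b : Fin n}
    (h : (ev a).proc = (ev b).proc) (hab : a ≤ b) : D.le a b :=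
  (le_iff_of_proc_eq (by rw [hD.proc, hD.proc, h])).2 hab

/-- Each closure condition is met by applying a rule to the very pair in its hypothesis. Strictness
of the conclusion comes from `w' ≠ w`, or from the two events being of different kinds. -/
theorem IsOrder.closed (hD : D.IsOrder t.ev X) (hM : M.Correct t.ev fun e => decide (e ∈ X))
    (h : ∀ a ∈ X, ∀ b ∈ X, a ≠ b → D.le a b → ∀ p, Imposes t.ev M a b p → D.le p.1 p.2) :
    t.Closed hD.toPartialOrder := by
  have hlt : ∀ a b : X, a.1 ≠ b.1 → D.le a b → hD.toPartialOrder.lt a b :=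
    fun a b hne hab => ⟨hab, fun hba => hne (hD.antisymm _ _ hab hba)⟩
  have hne : ∀ a b : X, hD.toPartialOrder.lt a b → a.1 ≠ b.1 :=
    fun a b hab h' => hab.2 (show D.le b a from h' ▸ D.le_refl a)
  refine ⟨fun r w w' hobs hop hloc hww hl => ?_, fun r w w' hobs hop hloc hww hl => ?_,
    fun a₁ l₁ a₂ l₂ hm₁ hm₂ hloc hll hl => ?_⟩
  · have hww' : w'.1 ≠ w.1 := fun h => hww (Subtype.ext h)
    obtain ⟨f, h₁, ⟨-, -, -, -, h₂⟩, h₃⟩ :=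
      (hM.beforeW r w').exists_of ⟨by simp, hop, hloc, rfl, le_rfl⟩
    -- `w'` is a candidate in its own process, so the last write at or before `w'` is `w'` itself.
    -- The other two rules use the same argument below.
    obtain rfl : w'.1 = f := h₃.elim id fun h₃ => absurd h₂ (not_le.2 h₃)
    exact hlt w' w hww' (h w' w'.2 r r.2 (hne _ _ hl) hl.1 (w', w) (Or.inr (Or.inl
      ⟨hobs.1, w', w, h₁, (Trace.obs_eq_some_iff hM hobs.1).2 hobs, hww', rfl⟩)))
  · obtain ⟨f, h₁, ⟨-, -, -, -, h₂⟩, h₃⟩ := (hM.afterW w w').exists_of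
      ⟨by simp, hop, hloc.trans hobs.2.2.1.symm, rfl, le_rfl⟩
    obtain rfl : w'.1 = f := h₃.elim id fun h₃ => absurd h₂ (not_le.2 h₃)
    -- Only the last read `r'` of the process observing `w` is pushed; since `r ≤ r'` in process
    -- order, `r' ≤ w'` gives `r ≤ w'`.
    obtain ⟨r', h₄, ⟨-, -, -, h₅⟩, h₆⟩ := (hM.flow w (t.ev r).proc).exists_of
      ⟨by simp, hobs.1, (Trace.obs_eq_some_iff hM hobs.1).2 hobs, rfl⟩
    refine hlt r w' (fun he => ?_) (hD.trans _ _ _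
      (hD.le_of_proc_eq h₅.symm (h₆.elim le_of_eq le_of_lt)) (h w w.2 w' w'.2 (hne _ _ hl) hl.1
        (r', w') (Or.inl ⟨hobs.2.1, w', _, r', h₁, h₄, rfl⟩)))
    have := hobs.1
    rw [he, hop] at this
    cases this
  · have hll' : l₁.1 ≠ l₂.1 := fun h => hll (Subtype.ext h)
    obtain ⟨f, h₁, ⟨-, -, -, -, h₂⟩, h₃⟩ := (hM.afterRel a₁ l₂).exists_of
      ⟨by simp, hm₂.2.1, hloc.symm.trans hm₁.2.2.1.symm, rfl, le_rfl⟩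
    obtain rfl : l₂.1 = f := h₃.elim id fun h₃ => absurd h₂ (not_le.2 h₃)
    obtain ⟨l, h₄, ⟨-, h₅, h₆⟩, -⟩ := (hM.relOf a₁).exists_of
      ⟨by simp, hm₁.2.1, hm₁.acqOf_eq hM⟩
    obtain rfl : l₁.1 = l := hm₁.release_unique ((Trace.acqOf_eq_some_iff hM h₅).1 h₆)
    refine hlt l₁ a₂ (fun he => ?_) (h a₁ a₁.2 l₂ l₂.2 (hne _ _ hl) hl.1 (l₁, a₂) (Or.inr (Or.inr
      ⟨hm₁.1, l₁, l₂, a₂, h₄, h₁, hm₂.acqOf_eq hM, hll', rfl⟩)))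
    have := hm₂.1
    rw [← he, hm₁.2.1] at this
    cases this

end DS

/-! ### Invariant and potential of the main loop -/

section Loop

variable {k n : ℕ} {t : Trace k n} {X : Finset (Fin n)} {P : PartialOrder X} {M : EventMaps k n}
  {D : DS k n} {Q : List (Fin n × Fin n)}

/-- The invariant of the main loop. -/
structure LoopInvariant (t : Trace k n) (P : PartialOrder X) (M : EventMaps k n) (D : DS k n)
    (Q : List (Fin n × Fin n)) : Prop where
  isOrder : D.IsOrder t.ev X
  refines : ∀ a b : X, P.le a b → D.le a b
  forced : ∀ R : PartialOrder X, Refines R P → t.Closed R → ∀ a b : X, D.le a b → R.le a b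
  mem : ∀ p ∈ Q, p.1 ∈ X ∧ p.2 ∈ X
  pending : ∀ R : PartialOrder X, Refines R P → t.Closed R →
    ∀ a b : X, (a.1, b.1) ∈ Q → R.lt a b
  rules : ∀ a ∈ X, ∀ b ∈ X, a ≠ b → D.le a b → ∀ p, Imposes t.ev M a b p → p ∈ Q ∨ D.le p.1 p.2

namespace LoopInvariant

theorem correct_of_nil (h : LoopInvariant t P M D [])
    (hM : M.Correct t.ev fun e => decide (e ∈ X)) : CorrectAnswer t P (Answer.order D) :=
  ⟨h.isOrder.toPartialOrder, ⟨h.refines, h.isOrder.closed hM fun a ha b hb hne hab p hp =>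
    (h.rules a ha b hb hne hab p hp).resolve_left List.not_mem_nil, h.forced⟩, fun _ _ => Iff.rfl⟩

theorem correct_bot {a b : Fin n} (h : LoopInvariant t P M D ((a, b) :: Q)) (hba : D.le b a) :
    CorrectAnswer t P Answer.bot := by
  rintro ⟨R, hR, hRc⟩
  obtain ⟨ha, hb⟩ : a ∈ X ∧ b ∈ X := h.mem (a, b) (by simp)
  have h₁ := h.pending R hR hRc ⟨a, ha⟩ ⟨b, hb⟩ (by simp)
  have h₂ := h.forced R hR hRc ⟨b, hb⟩ ⟨a, ha⟩ hba
  exact @not_le_of_gt _ R.toPreorder _ _ h₁ h₂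

theorem skip {a b : Fin n} (h : LoopInvariant t P M D ((a, b) :: Q)) (hab : D.le a b) :
    LoopInvariant t P M D Q where
  isOrder := h.isOrder
  refines := h.refines
  forced := h.forced
  mem p hp := h.mem p (by simp [hp])
  pending R hR hRc c d hcd := h.pending R hR hRc c d (by simp [hcd])
  rules x hx y hy hne hxy p hp := by
    rcases h.rules x hx y hy hne hxy p hp with h' | h'
    · rcases List.mem_cons.1 h' with rfl | h'
      exacts [Or.inr hab, Or.inl h']
    · exact Or.inr h'

/-- Pairs ordered before the insertion had their rules accounted for, and `newPairs` lists exactly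
the remaining ones. Everything added follows in each closed refinement from the pending ordering `a
< b`, so it is forced there too. -/
theorem insert (hX : t.Feasible X) (hP : t.Respects P)
    (hM : M.Correct t.ev fun e => decide (e ∈ X)) {a b : Fin n}
    (h : LoopInvariant t P M D ((a, b) :: Q)) (hba : ¬ D.le b a) :
    LoopInvariant t P M (D.insert a b).val (applyRules t.ev M (newPairs M D a b).val Q).val := by
  obtain ⟨ha, hb⟩ : a ∈ X ∧ b ∈ X := h.mem (a, b) (by simp)
  have hle := h.isOrder.insert_le_iff ha hb hba
  obtain ⟨l, hl, -, hmem, -⟩ := newPairs_spec hM h.isOrder.wf h.isOrder.proc ha hb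
  rw [List.append_nil] at hl
  have hforced : ∀ R : PartialOrder X, Refines R P → t.Closed R →
      ∀ x y : X, (D.insert a b).val.le x y → R.le x y := by
    intro R hR hRc x y hxy
    rcases (hle x y).1 hxy with hxy | ⟨h₁, h₂⟩
    · exact h.forced R hR hRc x y hxy
    · exact R.le_trans x ⟨a, ha⟩ y (h.forced R hR hRc x ⟨a, ha⟩ h₁)
        (R.le_trans _ ⟨b, hb⟩ y (@le_of_lt _ R.toPreorder _ _
          (h.pending R hR hRc ⟨a, ha⟩ ⟨b, hb⟩ (by simp))) (h.forced R hR hRc ⟨b, hb⟩ y h₂))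
  have hpush : ∀ e ∈ (newPairs M D a b).val, ∀ p, Imposes t.ev M e.1 e.2 p →
      ∀ R : PartialOrder X, Refines R P → t.Closed R → ∃ c d : X, p = (c.1, d.1) ∧ R.lt c d := by
    intro e he p hp R hR hRc
    rw [hl, hmem] at he
    obtain ⟨h₁, h₂, h₃, h₄, h₅, h₆⟩ := he
    have h₇ := hforced R hR hRc ⟨e.1, h₁⟩ ⟨e.2, h₂⟩ ((hle _ _).2 (Or.inr ⟨h₄, h₅⟩))
    -- New pairs join different processes, so their events are distinct; this turns `≤` into the
    -- strict order that the closure conditions require.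
    have h₈ : (⟨e.1, h₁⟩ : X) ≠ ⟨e.2, h₂⟩ := fun h =>
      h₃ (congrArg (fun z : X => (t.ev z).proc) h)
    exact Trace.Imposes.sound hX hP hM hR hRc (@lt_of_le_of_ne _ R _ _ h₇ h₈) hp
  have hmemX : ∀ e ∈ (newPairs M D a b).val, ∀ p, Imposes t.ev M e.1 e.2 p →
      p.1 ∈ X ∧ p.2 ∈ X := by
    intro e he p hp
    rw [hl, hmem] at he
    exact Trace.Imposes.mem hX hM he.2.1 hp
  refine ⟨h.isOrder.insert ha hb hba, fun x y hxy => (hle x y).2 (Or.inl (h.refines x y hxy)),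
    hforced, fun p hp => ?_, fun R hR hRc c d hcd => ?_, fun x hx y hy hne hxy p hp => ?_⟩
  · rcases mem_applyRules.1 hp with hp | ⟨e, he, hp⟩
    exacts [h.mem p (by simp [hp]), hmemX e he p hp]
  · rcases mem_applyRules.1 hcd with hcd | ⟨e, he, hcd⟩
    · exact h.pending R hR hRc c d (by simp [hcd])
    · obtain ⟨c', d', h₁, h₂⟩ := hpush e he _ hcd R hR hRc
      obtain ⟨h₃, h₄⟩ := Prod.mk.inj h₁
      rwa [Subtype.ext h₃, Subtype.ext h₄]
  · rw [mem_applyRules, hle]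
    by_cases hxy' : D.le x y
    · rcases h.rules x hx y hy hne hxy' p hp with h' | h'
      · rcases List.mem_cons.1 h' with rfl | h'
        exacts [Or.inr (Or.inr ⟨D.le_refl _, D.le_refl _⟩), Or.inl (Or.inl h')]
      · exact Or.inr (Or.inl h')
    · obtain ⟨h₁, h₂⟩ := ((hle x y).1 hxy).resolve_left hxy'
      refine Or.inl (Or.inr ⟨(x, y), ?_, hp⟩)
      rw [hl, hmem]
      -- A new pair cannot lie in one process: either it was ordered already, or `b ≤ y ≤ x ≤ a`
      -- contradicts `hba`.
      refine ⟨hx, hy, fun hproc => ?_, h₁, h₂, hxy'⟩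
      rcases le_total x y with h₃ | h₃
      · exact hxy' (h.isOrder.le_of_proc_eq hproc h₃)
      · have := h.isOrder.le_of_proc_eq hproc.symm h₃
        exact hba (h.isOrder.trans _ _ _ h₂ (h.isOrder.trans _ _ _ this h₁))

end LoopInvariant

/-- The number of pairs of events that are not ordered. -/
def DS.unordered (D : DS k n) : ℕ :=
  (Finset.univ.filter fun p : Fin n × Fin n => ¬ D.le p.1 p.2).card

theorem DS.unordered_le (D : DS k n) : D.unordered ≤ n ^ 2 :=
  (Finset.card_filter_le _ _).trans (by simp [sq])

/-- The listed pairs are distinct and leave the set of unordered pairs, and no pair enters it. -/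
theorem DS.unordered_add_length_le {D D' : DS k n} {l : List (Fin n × Fin n)} (hl : l.Nodup)
    (hle : ∀ x y, D.le x y → D'.le x y) (h : ∀ p ∈ l, ¬ D.le p.1 p.2 ∧ D'.le p.1 p.2) :
    D'.unordered + l.length ≤ D.unordered := by
  rw [← List.toFinset_card_of_nodup hl, DS.unordered, ← Finset.card_union_of_disjoint]
  · refine Finset.card_le_card fun p hp => ?_
    simp only [Finset.mem_union, Finset.mem_filter, Finset.mem_univ, true_and,
      List.mem_toFinset] at hp ⊢
    exact hp.elim (fun h₁ h₂ => h₁ (hle _ _ h₂)) fun h₁ => (h p h₁).1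
  · rw [Finset.disjoint_left]
    intro p hp hp'
    exact (Finset.mem_filter.1 hp).2 (h p (List.mem_toFinset.1 hp')).2

/-- A bound on the steps of one insertion, for trees of height `h`. -/
def insertCost (k h : ℕ) : ℕ :=
  k * (h + 4 + k * (k * k + 2 * h + 5)) + 1

/-- A bound on the steps of the main loop per ordering that is popped and pair that becomes
ordered, for trees of height `h`. -/
def iterationCost (k h : ℕ) : ℕ :=
  2 * (h + 2) + 1 + (h + 5) * ((3 * k + 3) * k + 1) + insertCost k h + (k + 5)

/-- In the potential `(k + 3) * D.unordered + Q.length`, a newly ordered pair releases `k + 3`: `k +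
2` cover the orderings it may push, and one is left to pay for enumerating it and applying the
rules. The same quantity shows that the fuel is never exhausted. -/
theorem closureLoop_spec (hX : t.Feasible X) (hP : t.Respects P)
    (hM : M.Correct t.ev fun e => decide (e ∈ X)) {fuel : ℕ} (h : LoopInvariant t P M D Q)
    (hfuel : (k + 3) * D.unordered + Q.length < fuel) :
    ∃ out, (closureLoop t.ev M fuel D Q).val = some out ∧ CorrectAnswer t P out ∧
      (closureLoop t.ev M fuel D Q).steps ≤
        iterationCost k (Nat.clog 2 n) * ((k + 3) * D.unordered + Q.length + 1) := by
  induction fuel generalizing D Q with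
  | zero => omega
  | succ fuel ih =>
    have hK₁ : 2 * (Nat.clog 2 n + 2) + 1 ≤ iterationCost k (Nat.clog 2 n) := by
      unfold iterationCost
      omega
    have hK₅ : ∀ m, iterationCost k (Nat.clog 2 n) ≤ iterationCost k (Nat.clog 2 n) * (m + 1) :=
      fun m => Nat.le_mul_of_pos_right _ m.succ_pos
    cases Q with
    | nil =>
      refine ⟨Answer.order D, rfl, h.correct_of_nil hM, ?_⟩
      change 1 ≤ _ * ((k + 3) * D.unordered + 0 + 1)
      have := hK₅ ((k + 3) * D.unordered + 0)
      omega
    | cons p Q =>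
      obtain ⟨a, b⟩ := p
      have hq₁ := D.steps_query_le b a
      have hq₂ := D.steps_query_le a b
      rw [List.length_cons] at hfuel ⊢
      by_cases hba : D.le b a
      · have hba' : (D.query b a).val = true := hba
        refine ⟨Answer.bot, by simp [closureLoop, hba'], h.correct_bot hba, ?_⟩
        simp only [closureLoop, Timed.steps_bind, Timed.steps_tick, hba', if_true,
          Timed.steps_pure]
        have := hK₅ ((k + 3) * D.unordered + (Q.length + 1))
        omega
      · have hba' : (D.query b a).val = false := Bool.eq_false_iff.2 hba
        by_cases hab : D.le a b
        · have hab' : (D.query a b).val = true := hab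
          obtain ⟨out, h₁, h₂, h₃⟩ := ih (h.skip hab) (by omega)
          refine ⟨out, by simpa [closureLoop, hba', hab'] using h₁, h₂, ?_⟩
          simp only [closureLoop, Timed.steps_bind, Timed.steps_tick, hba', hab', if_true,
            Bool.false_eq_true, if_false]
          rw [← add_assoc ((k + 3) * D.unordered), mul_add _ _ 1]
          omega
        · have hab' : (D.query a b).val = false := Bool.eq_false_iff.2 hab
          obtain ⟨ha, hb⟩ : a ∈ X ∧ b ∈ X := h.mem (a, b) (by simp)
          obtain ⟨l, hl, hnodup, hmem, hsteps⟩ :=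
            newPairs_spec hM h.isOrder.wf h.isOrder.proc ha hb
          rw [List.append_nil] at hl
          have hle := h.isOrder.insert_le_iff ha hb hba
          have hU := DS.unordered_add_length_le (D' := (D.insert a b).val) hnodup
            (fun x y hxy => (hle x y).2 (Or.inl hxy)) fun p hp =>
              ⟨((hmem p).1 hp).2.2.2.2.2,
                (hle _ _).2 (Or.inr ⟨((hmem p).1 hp).2.2.2.1, ((hmem p).1 hp).2.2.2.2.1⟩)⟩
          have hI := D.steps_insert_le a b
          have hR := steps_applyRules_le (ev := t.ev) (M := M) l Q
          have hlen := length_applyRules_le (ev := t.ev) (M := M) l Q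
          have hnext := h.insert hX hP hM hba
          rw [hl] at hnext
          set D' := (D.insert a b).val
          set Q' := (applyRules t.ev M l Q).val
          have hU' : (k + 3) * D'.unordered + (k + 3) * l.length ≤ (k + 3) * D.unordered := by
            rw [← mul_add]
            exact Nat.mul_le_mul_left _ hU
          have hmeas : (k + 3) * D'.unordered + Q'.length + l.length + 1 ≤
              (k + 3) * D.unordered + (Q.length + 1) := by
            nlinarith
          obtain ⟨out, h₁, h₂, h₃⟩ := ih hnext (by omega)
          refine ⟨out, by simpa [closureLoop, hba', hab', hl] using h₁, h₂, ?_⟩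
          simp only [closureLoop, Timed.steps_bind, Timed.steps_tick, hba', hab', hl,
            Bool.false_eq_true, if_false]
          have h₃' : (closureLoop t.ev M fuel (D.insert a b).val (applyRules t.ev M l Q).val).steps ≤
            _ := h₃
          -- The cost of one iteration with an insertion: the tick and two queries, the enumeration
          -- of the new pairs, the insertion, and the rules. It is charged to the popped ordering
          -- and the `l.length` new pairs.
          have hK₂ : 1 + 2 * (Nat.clog 2 n + 2) +
              (Nat.clog 2 n + 5) * (l.length + ((3 * k + 3) * k + 1)) +
              insertCost k (Nat.clog 2 n) + (l.length * (k + 4) + 1) ≤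
              iterationCost k (Nat.clog 2 n) * (l.length + 1) := by
            have : Nat.clog 2 n + 5 + (k + 4) ≤ iterationCost k (Nat.clog 2 n) := by
              unfold iterationCost
              nlinarith [Nat.zero_le ((Nat.clog 2 n + 5) * ((3 * k + 3) * k))]
            have := Nat.mul_le_mul_right l.length this
            unfold iterationCost at *
            nlinarith
          have hK₃ := Nat.mul_le_mul_left (iterationCost k (Nat.clog 2 n)) hmeas
          change _ ≤ insertCost k (Nat.clog 2 n) at hI
          have hK₄ : iterationCost k (Nat.clog 2 n) * ((k + 3) * D'.unordered + Q'.length + 1) +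
              iterationCost k (Nat.clog 2 n) * (l.length + 1) ≤
              iterationCost k (Nat.clog 2 n) * ((k + 3) * D.unordered + (Q.length + 1) + 1) := by
            rw [← mul_add]
            exact Nat.mul_le_mul_left _ (by omega)
          omega

/-! ### The initialization -/

/-- Insert all pairs of a matrix, and collect them. -/
def insertAll (lt : Fin n → Fin n → Bool) (D₀ : DS k n) :
    Timed (DS k n × List (Fin n × Fin n)) :=
  Timed.foreach (List.finRange n) (D₀, []) fun s e₁ =>
    Timed.foreach (List.finRange n) s fun (D, pairs) e₂ =>
      if lt e₁ e₂ then do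
        let D' ← D.insert e₁ e₂
        pure (D', (e₁, e₂) :: pairs)
      else pure (D, pairs)

theorem closureAlgorithm_eq (fuel : ℕ) (ev : Fin n → Event k) (X : Fin n → Bool)
    (lt : Fin n → Fin n → Bool) : closureAlgorithm fuel ev X lt =
      buildMaps ev X >>= fun M => DS.init (fun e => (ev e).proc) >>= fun D₀ =>
        insertAll lt D₀ >>= fun s => applyRules ev M s.2 [] >>= fun Q =>
          closureLoop ev M fuel s.1 Q := rfl

theorem ltMatrix_eq_true {a b : Fin n} : ltMatrix P a b = true ↔
    ∃ (ha : a ∈ X) (hb : b ∈ X), P.lt ⟨a, ha⟩ ⟨b, hb⟩ := by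
  simp [ltMatrix]

theorem length_insertAll_le (lt : Fin n → Fin n → Bool) (D₀ : DS k n) :
    (insertAll lt D₀).val.2.length ≤ n ^ 2 := by
  refine (Timed.foreach_measure_le (fun s : DS k n × List (Fin n × Fin n) => s.2.length) (c := n)
    fun s e₁ => ?_).trans (by simp [sq])
  refine (Timed.foreach_measure_le (fun s : DS k n × List (Fin n × Fin n) => s.2.length) (c := 1)
    fun s e₂ => ?_).trans (by simp)
  simp only [Timed.val_ite, Timed.val_bind, Timed.val_pure]
  split_ifs <;> simp

theorem steps_insertAll_le (lt : Fin n → Fin n → Bool) (D₀ : DS k n) :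
    (insertAll lt D₀).steps ≤ n * (n * (insertCost k (Nat.clog 2 n) + 1) + 2) + 1 := by
  refine (Timed.steps_foreach_le (c := n * (insertCost k (Nat.clog 2 n) + 1) + 1)
    fun s e₁ => ?_).trans (by simp)
  refine (Timed.steps_foreach_le (c := insertCost k (Nat.clog 2 n)) fun s e₂ => ?_).trans (by simp)
  have : _ ≤ insertCost k (Nat.clog 2 n) := s.1.steps_insert_le e₁ e₂
  simp only [Timed.steps_ite, Timed.steps_bind, Timed.steps_pure]
  split_ifs <;> omega

/-- The stored order restricted to `X` stays inside `P`, so no insertion can close a cycle; since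
every pair of `P` is inserted, the two finally coincide on `X`. Pairs within one process are listed
as well, and this is the only time the rules see them. -/
theorem insertAll_spec (ev : Fin n → Event k) (P : PartialOrder X)
    (hP : ∀ a b : X, (ev a).proc = (ev b).proc → a.1 < b.1 → P.lt a b) :
    let s := (insertAll (ltMatrix P) (DS.init fun e => (ev e).proc).val).val
    s.1.IsOrder ev X ∧ (∀ a b : X, s.1.le a b ↔ P.le a b) ∧
      ∀ e, e ∈ s.2 ↔ ltMatrix P e.1 e.2 = true := by
  let p : DS k n × List (Fin n × Fin n) → Prop := fun s =>
    s.1.IsOrder ev X ∧ (∀ a b : X, s.1.le a b → P.le a b) ∧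
      ∀ e ∈ s.2, ltMatrix P e.1 e.2 = true ∧ s.1.le e.1 e.2
  obtain ⟨⟨h₁, h₂, h₃⟩, h₄, -⟩ := Timed.foreach_induction_mem
    (l := List.finRange n) (s := ((DS.init fun e => (ev e).proc).val, []))
    (body := fun s e₁ => Timed.foreach (List.finRange n) s fun (D, pairs) e₂ =>
      if ltMatrix P e₁ e₂ then do
        let D' ← D.insert e₁ e₂
        pure (D', (e₁, e₂) :: pairs)
      else pure (D, pairs)) p
    (fun e₁ s => ∀ e₂, ltMatrix P e₁ e₂ = true → (e₁, e₂) ∈ s.2)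
    ⟨DS.IsOrder.init ev X, fun a b hab => by
      rw [DS.init_le_iff] at hab
      rcases hab.2.eq_or_lt with h | h
      · rw [Subtype.ext h]
        exact P.le_refl b
      · exact @le_of_lt _ P.toPreorder _ _ (hP a b hab.1 h), by simp⟩
    (fun s hs e₁ _ => by
      obtain ⟨h₁, h₂, h₃⟩ := Timed.foreach_induction_mem (l := List.finRange n) (s := s)
        (body := fun (D, pairs) e₂ =>
          if ltMatrix P e₁ e₂ then do
            let D' ← D.insert e₁ e₂
            pure (D', (e₁, e₂) :: pairs)
          else pure (D, pairs)) (fun s' => p s' ∧ s.2 ⊆ s'.2)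
        (fun e₂ s => ltMatrix P e₁ e₂ = true → (e₁, e₂) ∈ s.2) ⟨hs, fun _ => id⟩
        (fun s' hs' e₂ _ => by
          simp only [Timed.val_ite, Timed.val_bind, Timed.val_pure]
          by_cases h : ltMatrix P e₁ e₂ = true
          · rw [if_pos h]
            obtain ⟨⟨h₁, h₂, h₃⟩, h₄⟩ := hs'
            obtain ⟨ha, hb, hlt⟩ := ltMatrix_eq_true.1 h
            have hba : ¬ s'.1.le e₂ e₁ := fun hba =>
              @not_le_of_gt _ P.toPreorder _ _ hlt (h₂ ⟨e₂, hb⟩ ⟨e₁, ha⟩ hba)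
            have hle := h₁.insert_le_iff ha hb hba
            refine ⟨⟨⟨h₁.insert ha hb hba, fun x y hxy => ?_, fun e he => ?_⟩,
              fun e he => List.mem_cons_of_mem _ (h₄ he)⟩, fun _ => List.mem_cons_self,
              fun e he h => List.mem_cons_of_mem _ (he h)⟩
            · rcases (hle x y).1 hxy with hxy | ⟨hx, hy⟩
              · exact h₂ x y hxy
              · exact P.le_trans x ⟨e₁, ha⟩ y (h₂ x ⟨e₁, ha⟩ hx) (P.le_trans _ ⟨e₂, hb⟩ y
                  (@le_of_lt _ P.toPreorder _ _ hlt) (h₂ ⟨e₂, hb⟩ y hy))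
            · rcases List.mem_cons.1 he with rfl | he
              · exact ⟨h, (hle _ _).2 (Or.inr ⟨DS.le_refl _ _, DS.le_refl _ _⟩)⟩
              · exact ⟨(h₃ e he).1, (hle _ _).2 (Or.inl (h₃ e he).2)⟩
          · rw [if_neg h]
            exact ⟨hs', fun h' => absurd h' h, fun _ => id⟩)
      exact ⟨h₁.1, fun e₂ => h₂ e₂ (List.mem_finRange e₂), fun b hb e₂ he => h₁.2 (hb e₂ he)⟩)
  refine ⟨h₁, fun a b => ⟨h₂ a b, fun hab => ?_⟩, fun e =>
    ⟨fun he => (h₃ e he).1, fun he => h₄ e.1 (List.mem_finRange _) e.2 he⟩⟩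
  by_cases hne : a = b
  · rw [hne]
    exact DS.le_refl _ _
  · exact (h₃ (a.1, b.1) (h₄ a (List.mem_finRange _) b
      (ltMatrix_eq_true.2 ⟨a.2, b.2, @lt_of_le_of_ne _ P _ _ hab hne⟩))).2

/-- The structure coincides with `P` on `X`, and the rules have been applied to all strict pairs of
`P`, so every imposed ordering is on the worklist. -/
theorem LoopInvariant.init (hX : t.Feasible X) (hP : t.Respects P)
    (hM : M.Correct t.ev fun e => decide (e ∈ X)) :
    let s := (insertAll (ltMatrix P) (DS.init fun e => (t.ev e).proc).val).val
    LoopInvariant t P M s.1 (applyRules t.ev M s.2 []).val := by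
  intro s
  obtain ⟨h₁, h₂, h₃⟩ := insertAll_spec t.ev P hP.process_order
  refine ⟨h₁, fun a b => (h₂ a b).2, fun R hR _ a b hab => hR a b ((h₂ a b).1 hab),
    fun p hp => ?_, fun R hR hRc c d hcd => ?_, fun a ha b hb hne hab p hp => ?_⟩
  · obtain ⟨e, he, hp⟩ := (mem_applyRules.1 hp).resolve_left List.not_mem_nil
    obtain ⟨ha, hb, -⟩ := ltMatrix_eq_true.1 ((h₃ e).1 he)
    exact Trace.Imposes.mem hX hM hb hp
  · obtain ⟨e, he, hp⟩ := (mem_applyRules.1 hcd).resolve_left List.not_mem_nil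
    obtain ⟨ha, hb, hlt⟩ := ltMatrix_eq_true.1 ((h₃ e).1 he)
    have hne := @ne_of_lt _ P.toPreorder _ _ hlt
    obtain ⟨c', d', g₁, g₂⟩ := Trace.Imposes.sound hX hP hM hR hRc
      (@lt_of_le_of_ne _ R _ _ (hR _ _ (@le_of_lt _ P.toPreorder _ _ hlt)) hne) hp
    obtain ⟨g₃, g₄⟩ := Prod.mk.inj g₁
    rwa [Subtype.ext g₃, Subtype.ext g₄]
  · refine Or.inl (mem_applyRules.2 (Or.inr ⟨(a, b), (h₃ _).2 (ltMatrix_eq_true.2 ⟨ha, hb, ?_⟩), hp⟩))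
    exact @lt_of_le_of_ne _ P _ _ ((h₂ ⟨a, ha⟩ ⟨b, hb⟩).1 hab) fun h => hne (congrArg Subtype.val h)

theorem closureAlgorithm_spec (hX : t.Feasible X) (hP : t.Respects P) :
    ∃ out steps, ClosureRuns t P out steps ∧ CorrectAnswer t P out ∧
      steps ≤ 10 * (k + 4) * (n + 1) ^ 2 + (DS.init fun e => (t.ev e).proc).steps +
        (n * (n * (insertCost k (Nat.clog 2 n) + 1) + 2) + 1) + (n ^ 2 * (k + 4) + 1) +
        iterationCost k (Nat.clog 2 n) * ((2 * k + 5) * n ^ 2 + 1) := by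
  set Xb : Fin n → Bool := fun e => decide (e ∈ X) with hXb
  have hM := buildMaps_correct t.ev Xb
  have h₁ := steps_buildMaps_le t.ev Xb
  set M := (buildMaps t.ev Xb).val with hMdef
  set D₀ := (DS.init fun e => (t.ev e).proc).val with hD₀
  have h₂ := steps_insertAll_le (ltMatrix P) D₀
  have h₃ := length_insertAll_le (ltMatrix P) D₀
  have hinv := LoopInvariant.init hX hP hM
  set s := (insertAll (ltMatrix P) D₀).val with hs
  have h₄ := steps_applyRules_le (ev := t.ev) (M := M) s.2 []
  have h₅ := length_applyRules_le (ev := t.ev) (M := M) s.2 []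
  have h₆ := s.1.unordered_le
  set Q := (applyRules t.ev M s.2 []).val with hQ
  -- The fuel is the initial potential plus one.
  obtain ⟨out, h₇, h₈, h₉⟩ := closureLoop_spec hX hP hM hinv
    (Nat.lt_succ_self ((k + 3) * s.1.unordered + Q.length))
  refine ⟨out, (buildMaps t.ev Xb).steps + ((DS.init fun e => (t.ev e).proc).steps +
      ((insertAll (ltMatrix P) D₀).steps + ((applyRules t.ev M s.2 []).steps +
        (closureLoop t.ev M ((k + 3) * s.1.unordered + Q.length + 1) s.1 Q).steps))),
    ⟨(k + 3) * s.1.unordered + Q.length + 1, ?_⟩, h₈, ?_⟩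
  · rw [closureAlgorithm_eq, ← h₇]
    rfl
  -- At most `n ^ 2` unordered pairs weigh `k + 3` each, and at most `n ^ 2` initial pairs push `k +
  -- 2` orderings each.
  · have hm : (k + 3) * s.1.unordered + Q.length ≤ (2 * k + 5) * n ^ 2 := by
      have g₁ := Nat.mul_le_mul_left (k + 3) h₆
      have g₂ := Nat.mul_le_mul_right (k + 2) h₃
      simp only [List.length_nil] at h₅
      nlinarith
    have g₁ := Nat.mul_le_mul_left (iterationCost k (Nat.clog 2 n)) (Nat.succ_le_succ hm)
    have g₂ := Nat.mul_le_mul_right (k + 4) h₃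
    have h₉' : (closureLoop t.ev M ((k + 3) * s.1.unordered + Q.length + 1) s.1 Q).steps ≤
      iterationCost k (Nat.clog 2 n) * ((k + 3) * s.1.unordered + Q.length + 1) := h₉
    simp only [Nat.succ_eq_add_one] at g₁
    omega

end Loop

/-! ### The bounds -/

theorem two_pow_clog_le {n : ℕ} (hn : 2 ≤ n) : 2 ^ Nat.clog 2 n ≤ 2 * n := by
  have h₁ := Nat.pow_pred_clog_lt_self one_lt_two hn
  have h₂ := Nat.clog_pos one_lt_two hn
  obtain ⟨m, hm⟩ : ∃ m, Nat.clog 2 n = m + 1 := ⟨_, (Nat.succ_pred_eq_of_pos h₂).symm⟩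
  rw [hm] at h₁ ⊢
  rw [Nat.pred_succ] at h₁
  rw [pow_succ]
  omega

/-- From `2 ^ Nat.clog 2 n ≤ 2 * n` and `log 2 ≤ log n`, the left side is at most `log n / log 2 + 2
≤ 3 * log n / log 2`, and `3 / log 2 < 5`. -/
theorem clog_add_one_le_log {n : ℕ} (hn : 2 ≤ n) :
    ((Nat.clog 2 n + 1 : ℕ) : ℝ) ≤ 5 * Real.log n := by
  have h₁ : ((2 ^ Nat.clog 2 n : ℕ) : ℝ) ≤ ((2 * n : ℕ) : ℝ) :=
    Nat.cast_le.2 (two_pow_clog_le hn)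
  have hn₀ : (0 : ℝ) < n := by positivity
  have hn₂ : (2 : ℝ) ≤ n := by exact_mod_cast hn
  have h₂ := Real.log_le_log (by positivity) h₁
  push_cast at h₂ ⊢
  rw [Real.log_pow, Real.log_mul two_ne_zero hn₀.ne'] at h₂
  have h₃ := Real.log_le_log two_pos hn₂
  have h₄ := Real.log_two_gt_d9
  nlinarith [Nat.cast_nonneg (α := ℝ) (Nat.clog 2 n)]

/-- The cost is affine in `h`, with slope at most its value at `0`. -/
theorem insertCost_le (k h : ℕ) : insertCost k h ≤ insertCost k 0 * (h + 1) := by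
  unfold insertCost
  have h₁ := Nat.zero_le (k * h)
  have h₂ := Nat.zero_le (k * k * h)
  have h₃ := Nat.zero_le (k * k * (k * k) * h)
  nlinarith

theorem iterationCost_le (k h : ℕ) : iterationCost k h ≤ iterationCost k 0 * (h + 1) := by
  have h₁ := insertCost_le k h
  have h₂ := Nat.zero_le (k * h)
  have h₃ := Nat.zero_le (((3 * k + 3) * k) * h)
  unfold iterationCost
  nlinarith

/-- A bound on the steps of the initialization per event. -/
def initCost (k : ℕ) : ℕ :=
  11 + 2 * k + k * (6 * k + 3)

theorem DS.steps_init_le_mul {k n : ℕ} (hn : 2 ≤ n) (proc : Fin n → Fin k) :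
    (DS.init proc).steps ≤ initCost k * n := by
  have h₁ := DS.steps_init_le proc
  have h₂ := two_pow_clog_le hn
  have h₃ : Nat.clog 2 n < 2 ^ Nat.clog 2 n := Nat.lt_two_pow_self
  have h₄ : k * (k + 3 + k * (2 * 2 ^ Nat.clog 2 n + 1)) ≤ k * ((6 * k + 3) * n) := by
    refine Nat.mul_le_mul_left _ ?_
    have := Nat.mul_le_mul_left k h₂
    have := Nat.mul_le_mul_left k hn
    nlinarith
  have h₅ := Nat.mul_le_mul_left k hn
  unfold initCost
  nlinarith

/-- The constant of the bound on the steps of the algorithm. -/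
def closureCost (k : ℕ) : ℕ :=
  40 * (k + 4) + initCost k + (insertCost k 0 + 4) + (k + 5) + iterationCost k 0 * (2 * k + 6)

theorem closure_bound_le {k n s : ℕ} (hn : 2 ≤ n) (hs : s ≤ initCost k * n) :
    10 * (k + 4) * (n + 1) ^ 2 + s +
        (n * (n * (insertCost k (Nat.clog 2 n) + 1) + 2) + 1) + (n ^ 2 * (k + 4) + 1) +
        iterationCost k (Nat.clog 2 n) * ((2 * k + 5) * n ^ 2 + 1) ≤
      closureCost k * (n ^ 2 * (Nat.clog 2 n + 1)) := by
  have hI := insertCost_le k (Nat.clog 2 n)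
  have hK := iterationCost_le k (Nat.clog 2 n)
  generalize Nat.clog 2 n = h at *
  have h₁ : n ^ 2 ≤ n ^ 2 * (h + 1) := Nat.le_mul_of_pos_right _ h.succ_pos
  have h₂ : 2 * n ≤ n ^ 2 := by nlinarith
  -- Each of the five summands is compared with `n ^ 2 * (h + 1)`, and the coefficients add up to
  -- `closureCost k`. Here `(n + 1) ^ 2 ≤ 4 * n ^ 2` turns `10` into `40`.
  have g₁ : 10 * (k + 4) * (n + 1) ^ 2 ≤ 40 * (k + 4) * (n ^ 2 * (h + 1)) :=
    calc 10 * (k + 4) * (n + 1) ^ 2 ≤ 10 * (k + 4) * (4 * n ^ 2) :=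
          Nat.mul_le_mul_left _ (by nlinarith)
      _ = 40 * (k + 4) * n ^ 2 := by ring
      _ ≤ _ := Nat.mul_le_mul_left _ h₁
  have g₂ : s ≤ initCost k * (n ^ 2 * (h + 1)) :=
    hs.trans (Nat.mul_le_mul_left _ (by omega))
  have g₃ : n * (n * (insertCost k h + 1) + 2) + 1 ≤ (insertCost k 0 + 4) * (n ^ 2 * (h + 1)) := by
    have := Nat.mul_le_mul_left (n ^ 2) hI
    nlinarith
  have g₄ : n ^ 2 * (k + 4) + 1 ≤ (k + 5) * (n ^ 2 * (h + 1)) := by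
    have := Nat.mul_le_mul_left (k + 4) h₁
    nlinarith
  have g₅ : iterationCost k h * ((2 * k + 5) * n ^ 2 + 1) ≤
      iterationCost k 0 * (2 * k + 6) * (n ^ 2 * (h + 1)) :=
    calc iterationCost k h * ((2 * k + 5) * n ^ 2 + 1)
        ≤ iterationCost k 0 * (h + 1) * ((2 * k + 6) * n ^ 2) :=
          Nat.mul_le_mul hK (by nlinarith)
      _ = _ := by ring
  unfold closureCost
  simp only [add_mul] at *
  omega

theorem mainTheorem1 (k : ℕ) :
    ∃ C : ℝ,
      (∀ (n : ℕ) (t : Trace k n) (X : Finset (Fin n)) (P : PartialOrder X),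
        t.Feasible X → t.Respects P →
          ∃ (out : Answer k n) (steps : ℕ),
            ClosureRuns t P out steps ∧ CorrectAnswer t P out ∧
              (2 ≤ n → (steps : ℝ) ≤ C * (n : ℝ) ^ 2 * Real.log n)) ∧
      (∀ n : ℕ, 2 ≤ n →
        (∀ proc : Fin n → Fin k, ((DS.init proc).steps : ℝ) ≤ C * n) ∧
        (∀ (D : DS k n) (a b : Fin n),
          ((D.query a b).steps : ℝ) ≤ C * Real.log n ∧
            ((D.insert a b).steps : ℝ) ≤ C * Real.log n)) := by
  -- Passes from natural-number bounds with `Nat.clog` to real bounds with `Real.log`; `x` is `n ^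
  -- 2` for the algorithm and `1` for a single operation.
  have hlog : ∀ {n s c : ℕ} {x : ℕ}, 2 ≤ n → c ≤ closureCost k →
      s ≤ c * (x * (Nat.clog 2 n + 1)) → (s : ℝ) ≤ 5 * closureCost k * x * Real.log n := by
    intro n s c x hn hc hs
    calc (s : ℝ) ≤ ((closureCost k * x * (Nat.clog 2 n + 1) : ℕ) : ℝ) := by
          rw [mul_assoc]
          exact Nat.cast_le.2 (hs.trans (Nat.mul_le_mul_right _ hc))
      _ = closureCost k * x * ((Nat.clog 2 n + 1 : ℕ) : ℝ) := by push_cast; ring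
      _ ≤ closureCost k * x * (5 * Real.log n) :=
          mul_le_mul_of_nonneg_left (clog_add_one_le_log hn) (by positivity)
      _ = _ := by ring
  refine ⟨5 * closureCost k, fun n t X P hX hP => ?_, fun n hn => ⟨fun proc => ?_,
    fun D a b => ⟨?_, ?_⟩⟩⟩
  · obtain ⟨out, steps, h₁, h₂, h₃⟩ := closureAlgorithm_spec hX hP
    refine ⟨out, steps, h₁, h₂, fun hn => ?_⟩
    exact_mod_cast hlog hn le_rfl (h₃.trans (closure_bound_le hn (DS.steps_init_le_mul hn _)))
  · have h₁ : (DS.init proc).steps ≤ 5 * closureCost k * n :=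
      (DS.steps_init_le_mul hn proc).trans
        (Nat.mul_le_mul_right _ (by unfold closureCost; omega))
    exact_mod_cast h₁
  · simpa using hlog (c := 2) (x := 1) hn (by unfold closureCost; omega)
      ((D.steps_query_le a b).trans (by omega))
  · have h₁ : _ ≤ insertCost k (Nat.clog 2 n) := D.steps_insert_le a b
    simpa using hlog (c := insertCost k 0) (x := 1) hn (by unfold closureCost; omega)
      (h₁.trans ((insertCost_le k _).trans_eq (by rw [one_mul])))
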